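/- Let $d\ge 1$, let $c_1,\dots,c_5\in[0,+\infty)$ with $0<c_1\le c_3$, and let $\sigma\colon[0,+\infty)\to[0,+\infty)$ be continuous with $\sigma(0)=0$ and $\limsup_{t\to+\infty}\sigma(t)/t<+\infty$. For a matrix $A\in\mathbb{R}^{d\times d}$ let $|A|$ be its Frobenius norm; $\mathcal{L}^d$ is the Lebesgue measure, $\mathcal{H}^{d-1}$ the $(d-1)$-dimensional Hausdorff measure, $\mathcal{B}(\mathbb{R}^d)$ the Borel $\sigma$-algebra, and $BD(U)$ the space of those $u\in L^1(U;\mathbb{R}^d)$ whose distributional symmetric gradient $Eu=\frac12(Du+Du^T)$ is a bounded Radon measure on $U$ with values in the symmetric $d\times d$ matrices; $|Eu|$ is its total variation with respect to the Frobenius norm. Let $\mathfrak{F}$ be the collection of all functionals $F\colon L^1_{\rm loc}(\mathbb{R}^d;\mathbb{R}^d)\times\mathcal{B}(\mathbb{R}^d)\to[0,+\infty]$ such that: (a) for every $u\in L^1_{\rm loc}(\mathbb{R}^d;\mathbb{R}^d)$ the set function $F(u,\cdot)$ is a Borel measure, and $F(u,B)=\inf\{F(u,U): U\supset B,\ U\text{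 open}\}$ for every $B\in\mathcal{B}(\mathbb{R}^d)$; (b) $F(u,U)=F(v,U)$ whenever $U$ is bounded and open, $u,v\in L^1_{\rm loc}(\mathbb{R}^d;\mathbb{R}^d)$, and $u=v$ $\mathcal{L}^d$-a.e. on $U$; (c) for every $u\in L^1_{\rm loc}(\mathbb{R}^d;\mathbb{R}^d)$ and every bounded open $U$: if $u|_U\in BD(U)$, then $c_1|Eu|(U)-c_2\mathcal{L}^d(U)\le F(u,U)\le c_3|Eu|(U)+c_4\mathcal{L}^d(U)$, while $F(u,U)=+\infty$ if $u|_U\notin BD(U)$; (d) $F(u+w,B)=F(u,B)$ for every $u\in L^1_{\rm loc}(\mathbb{R}^d;\mathbb{R}^d)$, $B\in\mathcal{B}(\mathbb{R}^d)$, and every rigid motion $w(x)=Ax+b$ with $A$ antisymmetric and $b\in\mathbb{R}^d$; (e) $F(u+\ell_A,B)\le F(u,B)+c_5|A|\mathcal{L}^d(B)$ for every $u\in L^1_{\rm loc}(\mathbb{R}^d;\mathbb{R}^d)$, $B\in\mathcal{B}(\mathbb{R}^d)$, and every symmetric matrix $A$, where $\ell_A(y)=Ay$; (f) $F(u+u_{x,\zeta,\nu},B)\le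 F(u,B)+\sigma(|\zeta|)\,\mathcal{H}^{d-1}(B\cap\Pi^\nu_x)$ for every $u\in L^1_{\rm loc}(\mathbb{R}^d;\mathbb{R}^d)$, $B\in\mathcal{B}(\mathbb{R}^d)$, $x,\zeta\in\mathbb{R}^d$, and every unit vector $\nu$, where $u_{x,\zeta,\nu}(y)=\zeta$ if $(y-x)\cdot\nu>0$, $u_{x,\zeta,\nu}(y)=0$ if $(y-x)\cdot\nu\le0$, and $\Pi^\nu_x=\{y:(y-x)\cdot\nu=0\}$. Let $\mathfrak{F}_{\rm sc}$ be the collection of those $F\in\mathfrak{F}$ such that $F(\cdot,U)$ is $L^1_{\rm loc}$-lower semicontinuous for every open $U\subset\mathbb{R}^d$. Theorem (compactness). For every sequence $(F_n)_{n\in\mathbb{N}}$ in $\mathfrak{F}$ there exist $F\in\mathfrak{F}_{\rm sc}$ and a subsequence $(F_{n_k})_k$ such that for every bounded open set $U\subset\mathbb{R}^d$ the sequence $(F_{n_k}(\cdot,U))_k$ $\Gamma$-converges to $F(\cdot,U)$ in the topology of $L^1_{\rm loc}(\mathbb{R}^d;\mathbb{R}^d)$. -/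

import Mathlib

open MeasureTheory Filter Topology TopologicalSpace
open scoped ENNReal NNReal ContDiff Matrix

noncomputable section

namespace BDCompactness

/-- The Euclidean space `ℝ^d`. -/
abbrev Rd (d : ℕ) : Type := EuclideanSpace ℝ (Fin d)

/-- The space `ℝ^{d×d}`; its Euclidean norm is the Frobenius norm of matrices. -/
abbrev Rdd (d : ℕ) : Type := EuclideanSpace ℝ (Fin d × Fin d)

/-- The Frobenius norm of a matrix. -/
def frobNorm {d : ℕ} (A : Matrix (Fin d) (Fin d) ℝ) : ℝ := √(∑ i, ∑ j, A i j ^ 2)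

section L1loc

variable {d : ℕ}

/-- The subspace of (classes of a.e. equal) locally integrable vector fields. -/
def l1locSubmodule (d : ℕ) : Submodule ℝ (Rd d →ₘ[volume] Rd d) where
  carrier := {u | LocallyIntegrable u volume}
  zero_mem' := (locallyIntegrable_zero (μ := (volume : Measure (Rd d)))).congr
    (AEEqFun.coeFn_zero (μ := (volume : Measure (Rd d)))).symm
  add_mem' := fun {u v} hu hv =>
    LocallyIntegrable.congr (LocallyIntegrable.add hu hv) (AEEqFun.coeFn_add u v).symm
  smul_mem' := fun c u hu =>
    LocallyIntegrable.congr (LocallyIntegrable.smul hu c) (AEEqFun.coeFn_smul c u).symm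

/-- The space `L¹_loc(ℝ^d;ℝ^d)`. -/
def L1loc (d : ℕ) : Type := l1locSubmodule d

instance : AddCommGroup (L1loc d) := inferInstanceAs (AddCommGroup (l1locSubmodule d))

instance : Module ℝ (L1loc d) := inferInstanceAs (Module ℝ (l1locSubmodule d))

/-- A representative of an element of `L¹_loc(ℝ^d;ℝ^d)`. -/
def L1loc.toFun (u : L1loc d) : Rd d → Rd d := u.1

instance : CoeFun (L1loc d) (fun _ => Rd d → Rd d) := ⟨L1loc.toFun⟩

theorem L1loc.locallyIntegrable (u : L1loc d) : LocallyIntegrable u volume := u.2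

/-- The class in `L¹_loc(ℝ^d;ℝ^d)` of a locally integrable function. -/
def L1loc.mk (f : Rd d → Rd d) (hf : LocallyIntegrable f volume) : L1loc d :=
  ⟨AEEqFun.mk f hf.aestronglyMeasurable, hf.congr (AEEqFun.coeFn_mk f _).symm⟩

theorem L1loc.memLp (u : L1loc d) (k : ℕ) :
    MemLp u 1 (volume.restrict (Metric.closedBall (0 : Rd d) k)) :=
  memLp_one_iff_integrable.2
    (u.locallyIntegrable.integrableOn_isCompact (isCompact_closedBall _ _))

/-- The restriction of an element of `L¹_loc(ℝ^d;ℝ^d)` to the closed ball of radius `k`,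
as an element of `L¹`. -/
def L1loc.toL1Ball (k : ℕ) (u : L1loc d) :
    Lp (Rd d) 1 (volume.restrict (Metric.closedBall (0 : Rd d) k)) :=
  (u.memLp k).toLp u

/-- The topology of `L¹_loc(ℝ^d;ℝ^d)`: convergence in `L¹` on all balls centred at the origin
with integer radius, that is, on all compact sets. -/
instance : TopologicalSpace (L1loc d) :=
  TopologicalSpace.induced (fun u (k : ℕ) => L1loc.toL1Ball k u) inferInstance

theorem locallyIntegrable_affine (A : Matrix (Fin d) (Fin d) ℝ) (b : Rd d) :
    LocallyIntegrable (fun y : Rd d => Matrix.toEuclideanLin A y + b) volume :=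
  ((LinearMap.continuous_of_finiteDimensional (Matrix.toEuclideanLin A)).add
    continuous_const).locallyIntegrable

/-- The affine function `y ↦ A y + b`, as an element of `L¹_loc(ℝ^d;ℝ^d)`. -/
def affine (A : Matrix (Fin d) (Fin d) ℝ) (b : Rd d) : L1loc d :=
  L1loc.mk (fun y => Matrix.toEuclideanLin A y + b) (locallyIntegrable_affine A b)

/-- The function equal to `ζ` where `(y - x) · ν > 0` and to `0` where `(y - x) · ν ≤ 0`. -/
def jumpFun (x ζ ν : Rd d) (y : Rd d) : Rd d :=
  Set.indicator {y : Rd d | 0 < inner ℝ (y - x) ν} (fun _ => ζ) y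

theorem locallyIntegrable_jumpFun (x ζ ν : Rd d) : LocallyIntegrable (jumpFun x ζ ν) volume :=
  (locallyIntegrable_const ζ).indicator
    (isOpen_lt continuous_const (by fun_prop)).measurableSet

/-- The function `jumpFun x ζ ν`, as an element of `L¹_loc(ℝ^d;ℝ^d)`. -/
def jump (x ζ ν : Rd d) : L1loc d := L1loc.mk (jumpFun x ζ ν) (locallyIntegrable_jumpFun x ζ ν)

end L1loc

section BD

variable {d : ℕ}

/-- The bounded vector measure `μ`, considered on the open set `U`, is the distributional symmetric
gradient `Eu = (Du + Duᵀ)/2` of `u` on `U`. Only the values of `μ` on Borel subsets of `U` matter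
(there they are automatically symmetric matrices): a measure on `U` may be extended by zero. -/
structure IsSymGradient (u : L1loc d) (U : Set (Rd d)) (μ : VectorMeasure (Rd d) (Rdd d)) :
    Prop where
  bounded : μ.variation Set.univ < ⊤
  eq : ∀ φ : Rd d → ℝ, ContDiff ℝ ∞ φ → HasCompactSupport φ → tsupport φ ⊆ U →
    ∀ i j : Fin d, (∫ᵛ x, φ x ∂•μ) (i, j) =
      -∫ x, (1 / 2 : ℝ) * (u x i * fderiv ℝ φ x (EuclideanSpace.single j 1) +
        u x j * fderiv ℝ φ x (EuclideanSpace.single i 1))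

/-- The restriction of `u` to the open set `U` belongs to `BD(U)`. -/
def IsBD (u : L1loc d) (U : Set (Rd d)) : Prop :=
  IntegrableOn u U volume ∧ ∃ μ, IsSymGradient u U μ

end BD

section GammaConvergence

variable {X : Type*} [TopologicalSpace X]

/-- The Γ-lower limit of a sequence of functions on a topological space. -/
def gammaLiminf (f : ℕ → X → ℝ≥0∞) (x : X) : ℝ≥0∞ :=
  ⨆ V ∈ 𝓝 x, liminf (fun n => ⨅ y ∈ V, f n y) atTop

/-- The Γ-upper limit of a sequence of functions on a topological space. -/
def gammaLimsup (f : ℕ → X → ℝ≥0∞) (x : X) : ℝ≥0∞ :=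
  ⨆ V ∈ 𝓝 x, limsup (fun n => ⨅ y ∈ V, f n y) atTop

/-- The sequence `f` Γ-converges to `g`. -/
def GammaConverges (f : ℕ → X → ℝ≥0∞) (g : X → ℝ≥0∞) : Prop :=
  ∀ x, gammaLiminf f x = g x ∧ gammaLimsup f x = g x

end GammaConvergence

section Functionals

variable {d : ℕ}

/-- The Borel σ-algebra `𝓑(ℝ^d)`. -/
abbrev BorelSets (d : ℕ) : Type := {B : Set (Rd d) // MeasurableSet B}

/-- An open set, as a Borel set. -/
def openSet (U : Opens (Rd d)) : BorelSets d := ⟨U, U.isOpen.measurableSet⟩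

/-- The class `𝔉` of abstract functionals with constants `c₁, …, c₅` and modulus `σ`. -/
structure ClassF (c₁ c₂ c₃ c₄ c₅ : ℝ≥0) (σ : ℝ≥0 → ℝ≥0)
    (F : L1loc d → BorelSets d → ℝ≥0∞) : Prop where
  /-- measure property -/
  measure : ∀ u, ∃ μ : Measure (Rd d), ∀ B : BorelSets d, F u B = μ B
  /-- outer regularity, part of the measure property -/
  outer_regular : ∀ u (B : BorelSets d),
    F u B = ⨅ (U : Opens (Rd d)) (_ : (B : Set (Rd d)) ⊆ U), F u (openSet U)
  /-- locality on bounded open sets -/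
  locality : ∀ U : Opens (Rd d), Bornology.IsBounded (U : Set (Rd d)) → ∀ u v : L1loc d,
    (∀ᵐ x ∂volume.restrict (U : Set (Rd d)), u x = v x) → F u (openSet U) = F v (openSet U)
  /-- lower bound -/
  lower_bound : ∀ U : Opens (Rd d), Bornology.IsBounded (U : Set (Rd d)) → ∀ u : L1loc d,
    IsBD u U → ∀ μ, IsSymGradient u U μ →
      c₁ * μ.variation U ≤ F u (openSet U) + c₂ * volume (U : Set (Rd d))
  /-- upper bound -/
  upper_bound : ∀ U : Opens (Rd d), Bornology.IsBounded (U : Set (Rd d)) → ∀ u : L1loc d,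
    IsBD u U → ∀ μ, IsSymGradient u U μ →
      F u (openSet U) ≤ c₃ * μ.variation U + c₄ * volume (U : Set (Rd d))
  /-- the functional is infinite outside `BD` -/
  eq_top : ∀ U : Opens (Rd d), Bornology.IsBounded (U : Set (Rd d)) → ∀ u : L1loc d,
    ¬ IsBD u U → F u (openSet U) = ⊤
  /-- invariance under rigid motions -/
  rigid : ∀ (u : L1loc d) (A : Matrix (Fin d) (Fin d) ℝ) (b : Rd d), Aᵀ = -A →
    ∀ B, F (u + affine A b) B = F u B
  /-- bulk continuity estimate -/
  bulk : ∀ (u : L1loc d) (A : Matrix (Fin d) (Fin d) ℝ), Aᵀ = A → ∀ B : BorelSets d,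
    F (u + affine A 0) B ≤
      F u B + c₅ * ENNReal.ofReal (frobNorm A) * volume (B : Set (Rd d))
  /-- surface continuity estimate -/
  surface : ∀ (u : L1loc d) (x ζ ν : Rd d), ‖ν‖ = 1 → ∀ B : BorelSets d,
    F (u + jump x ζ ν) B ≤
      F u B + σ ‖ζ‖₊ * μHE[d - 1] ((B : Set (Rd d)) ∩ {y | inner ℝ (y - x) ν = 0})

/-- The class `𝔉_sc` of the functionals in `𝔉` that are `L¹_loc`-lower semicontinuous on
every open set. -/
structure ClassFsc (c₁ c₂ c₃ c₄ c₅ : ℝ≥0) (σ : ℝ≥0 → ℝ≥0)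
    (F : L1loc d → BorelSets d → ℝ≥0∞) : Prop extends ClassF c₁ c₂ c₃ c₄ c₅ σ F where
  lsc : ∀ U : Opens (Rd d), LowerSemicontinuous (fun u => F u (openSet U))

end Functionals

end BDCompactness

end

noncomputable section

namespace BDCompactness

/-! ### The topology of L¹_loc: neighbourhoods and second countability. -/

section L1locTopology

variable {d : ℕ}

/-! The proof is De Giorgi's localization method. Since `L1loc d` is second countable, compactness
of a countable power of [0,∞] yields a subsequence along which Γ-upper and Γ-lower limits agree
simultaneously on all finite unions of sets from a countable base of ℝ^d. Monotonicity in the set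
then bounds the Γ-upper limit on V by the Γ-lower limit on U whenever V is compactly contained in U
(`exists_strictMono_gammaLimsup_le_gammaLiminf`). The candidate limit on open sets is `innerReg`,
the supremum of the Γ-upper limit over compactly contained open sets; `limitFunctional` extends it
to Borel sets by outer regularity.

The De Giorgi–Letta argument makes this a measure. Superadditivity on disjoint sets is inherited
from Γ-lower limits. Subadditivity is the fundamental estimate `gammaLimsup_sup_le`: two
near-optimal functions are glued by a cut-off whose transition layer is selected among N disjoint
ones, so that it carries at most 1/N of the available energy.

The growth bounds are handled through `totalVar`, the total variation of Eu defined by duality. It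
is a supremum of continuous functionals, hence lower semicontinuous, and it obeys a product estimate
under gluing. A Riesz theorem for matrix-valued measures (`exists_density`) and uniqueness of the
representing measure identify it with |Eu|(U) (`variation_eq_totalVar`). The same bounds show that
on a bounded U the inner envelope loses nothing: if u is in BD(U), a thin boundary layer has small
|Eu| and small volume, hence small energy; otherwise coercivity makes the envelope infinite. So the
envelope is the Γ-limit on every bounded open set.

Conditions (d), (e), (f) all say that adding a fixed function costs at most a fixed measure.
Translations of `L1loc d` are continuous, so such estimates pass to the limit
(`limitFunctional_add_le`). -/

theorem L1loc.coeFn_add (u v : L1loc d) : (u + v : L1loc d) =ᵐ[volume] fun x => u x + v x :=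
  AEEqFun.coeFn_add u.1 v.1

theorem L1loc.coeFn_sub (u v : L1loc d) : (u - v : L1loc d) =ᵐ[volume] fun x => u x - v x :=
  AEEqFun.coeFn_sub u.1 v.1

theorem L1loc.coeFn_mk (f : Rd d → Rd d) (hf : LocallyIntegrable f volume) :
    L1loc.mk f hf =ᵐ[volume] f :=
  AEEqFun.coeFn_mk f hf.aestronglyMeasurable

theorem L1loc.aestronglyMeasurable (u : L1loc d) : AEStronglyMeasurable u volume :=
  u.locallyIntegrable.aestronglyMeasurable

theorem L1loc.ext {u v : L1loc d} (h : u =ᵐ[volume] v) : u = v :=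
  Subtype.ext (AEEqFun.ext h)

theorem L1loc.mk_add_mk (f g : Rd d → Rd d) (hf : LocallyIntegrable f volume)
    (hg : LocallyIntegrable g volume) :
    L1loc.mk f hf + L1loc.mk g hg = L1loc.mk (fun x => f x + g x) (hf.add hg) := by
  apply L1loc.ext
  filter_upwards [L1loc.coeFn_add (L1loc.mk f hf) (L1loc.mk g hg), L1loc.coeFn_mk f hf,
    L1loc.coeFn_mk g hg, L1loc.coeFn_mk (fun x => f x + g x) (hf.add hg)] with x h1 h2 h3 h4
  rw [h1, h2, h3, h4]

/-- The `L¹` norm on the closed ball of radius `k` centred at the origin. -/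
def L1loc.ballNorm (k : ℕ) (u : L1loc d) : ℝ≥0∞ :=
  ∫⁻ x in Metric.closedBall (0 : Rd d) k, ‖u x‖ₑ

theorem L1loc.ballNorm_mono (u : L1loc d) {k l : ℕ} (h : k ≤ l) : u.ballNorm k ≤ u.ballNorm l :=
  lintegral_mono_set (Metric.closedBall_subset_closedBall (by exact_mod_cast h))

theorem L1loc.edist_toL1Ball (k : ℕ) (u v : L1loc d) :
    edist (L1loc.toL1Ball k u) (L1loc.toL1Ball k v) = (u - v).ballNorm k := by
  rw [L1loc.toL1Ball, L1loc.toL1Ball, Lp.edist_toLp_toLp, eLpNorm_one_eq_lintegral_enorm]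
  apply lintegral_congr_ae
  filter_upwards [ae_restrict_of_ae (L1loc.coeFn_sub u v)] with x hx
  rw [hx]; rfl

/-- The ball norms increase with the radius, so finitely many conditions reduce to one on the
largest ball. -/
theorem L1loc.nhds_basis (u : L1loc d) :
    (𝓝 u).HasBasis (fun p : ℕ × ℝ≥0∞ => 0 < p.2) fun p => {v | (v - u).ballNorm p.1 < p.2} := by
  constructor
  intro W
  rw [nhds_induced, mem_comap]
  constructor
  · rintro ⟨t, ht, htW⟩
    rw [nhds_pi, Filter.mem_pi] at ht
    obtain ⟨I, hI, s, hs, hIs⟩ := ht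
    choose ε hε hεs using fun k => EMetric.mem_nhds_iff.1 (hs k)
    obtain ⟨N, hN⟩ := hI.bddAbove
    -- If `I` is empty the infimum is `⊤`, which is an admissible radius.
    refine ⟨(N, hI.toFinset.inf ε), ?_, ?_⟩
    · rw [Finset.lt_inf_iff]
      · exact fun k _ => hε k
      · exact ENNReal.zero_lt_top
    · intro v hv
      apply htW
      apply hIs
      intro k hk
      apply hεs
      change edist _ _ < _
      rw [L1loc.edist_toL1Ball]
      exact ((L1loc.ballNorm_mono _ (hN hk)).trans_lt hv).trans_le
        (Finset.inf_le (hI.mem_toFinset.2 hk))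
  · rintro ⟨⟨k, ε⟩, hε, h⟩
    refine ⟨(fun w => w k) ⁻¹' Metric.eball (L1loc.toL1Ball k u) ε, ?_, ?_⟩
    · exact (continuous_apply k).continuousAt.preimage_mem_nhds (Metric.eball_mem_nhds _ hε)
    · intro v hv
      apply h
      change edist _ _ < _ at hv
      rwa [L1loc.edist_toL1Ball] at hv

/-- The topology is induced from a countable product of separable L¹ spaces. This is what makes
Γ-compactness available. -/
instance : SecondCountableTopology (L1loc d) := by
  have : Fact ((1 : ℝ≥0∞) ≠ ⊤) := ⟨ENNReal.one_ne_top⟩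
  have : ∀ k : ℕ, SecondCountableTopology
      (Lp (Rd d) 1 (volume.restrict (Metric.closedBall (0 : Rd d) k))) := fun k =>
    Lp.SecondCountableTopology
  exact secondCountableTopology_induced _ _ _

theorem L1loc.continuous_add_right (h : L1loc d) : Continuous fun u : L1loc d => u + h := by
  rw [continuous_iff_continuousAt]
  intro u
  rw [ContinuousAt, (L1loc.nhds_basis u).tendsto_iff (L1loc.nhds_basis _)]
  rintro ⟨k, ε⟩ hε
  refine ⟨(k, ε), hε, fun v hv => ?_⟩
  simpa using hv

end L1locTopology

/-! ### Gluing two fields with a cut-off function. -/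

section Blend

variable {d : ℕ}

/-- A cut-off function: smooth, compactly supported, with values in `[0, 1]`. -/
structure IsCutoff (φ : Rd d → ℝ) : Prop where
  contDiff : ContDiff ℝ ∞ φ
  hasCompactSupport : HasCompactSupport φ
  nonneg : ∀ x, 0 ≤ φ x
  le_one : ∀ x, φ x ≤ 1

theorem locallyIntegrable_blend {φ : Rd d → ℝ} (hφ : IsCutoff φ) (y z : L1loc d) :
    LocallyIntegrable (fun x => φ x • y x + (1 - φ x) • z x) volume := by
  have hc : Continuous φ := hφ.contDiff.continuous
  refine LocallyIntegrable.add ?_ ?_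
  · exact y.locallyIntegrable.mono (hc.aestronglyMeasurable.smul y.aestronglyMeasurable)
      (.of_forall fun x => by
        rw [norm_smul, Real.norm_of_nonneg (hφ.nonneg x)]
        exact mul_le_of_le_one_left (norm_nonneg _) (hφ.le_one x))
  · exact z.locallyIntegrable.mono
      ((continuous_const.sub hc).aestronglyMeasurable.smul z.aestronglyMeasurable)
      (.of_forall fun x => by
        rw [norm_smul, Real.norm_of_nonneg (sub_nonneg.2 (hφ.le_one x))]
        exact mul_le_of_le_one_left (norm_nonneg _) (by linarith [hφ.nonneg x]))

/-- The convex combination `φ y + (1 - φ) z` of two fields. -/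
def blend {φ : Rd d → ℝ} (hφ : IsCutoff φ) (y z : L1loc d) : L1loc d :=
  L1loc.mk _ (locallyIntegrable_blend hφ y z)

theorem coeFn_blend {φ : Rd d → ℝ} (hφ : IsCutoff φ) (y z : L1loc d) :
    blend hφ y z =ᵐ[volume] fun x => φ x • y x + (1 - φ x) • z x :=
  L1loc.coeFn_mk _ _

/-- The difference is a pointwise convex combination of y - u and z - u; hence gluing two fields
close to u stays close to u. -/
theorem ballNorm_blend_sub_le {φ : Rd d → ℝ} (hφ : IsCutoff φ) (y z u : L1loc d) (k : ℕ) :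
    (blend hφ y z - u).ballNorm k ≤ (y - u).ballNorm k + (z - u).ballNorm k := by
  rw [L1loc.ballNorm, L1loc.ballNorm, L1loc.ballNorm, ← lintegral_add_left']
  · apply lintegral_mono_ae
    filter_upwards [ae_restrict_of_ae (L1loc.coeFn_sub (blend hφ y z) u),
      ae_restrict_of_ae (L1loc.coeFn_sub y u), ae_restrict_of_ae (L1loc.coeFn_sub z u),
      ae_restrict_of_ae (coeFn_blend hφ y z)] with x h1 h2 h3 h4
    rw [h1, h2, h3, h4]
    have : φ x • y x + (1 - φ x) • z x - u x
        = φ x • (y x - u x) + (1 - φ x) • (z x - u x) := by module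
    rw [this]
    refine (enorm_add_le _ _).trans (add_le_add ?_ ?_)
    · rw [enorm_smul]
      refine mul_le_of_le_one_left' ?_
      rw [Real.enorm_of_nonneg (hφ.nonneg x)]
      exact ENNReal.ofReal_le_one.2 (hφ.le_one x)
    · rw [enorm_smul]
      refine mul_le_of_le_one_left' ?_
      rw [Real.enorm_of_nonneg (sub_nonneg.2 (hφ.le_one x))]
      exact ENNReal.ofReal_le_one.2 (by linarith [hφ.nonneg x])
  · exact (y - u).aestronglyMeasurable.restrict.enorm

theorem ballNorm_sub_le (y z u : L1loc d) (k : ℕ) :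
    (y - z).ballNorm k ≤ (y - u).ballNorm k + (z - u).ballNorm k := by
  rw [L1loc.ballNorm, L1loc.ballNorm, L1loc.ballNorm, ← lintegral_add_left']
  · apply lintegral_mono_ae
    filter_upwards [ae_restrict_of_ae (L1loc.coeFn_sub y z),
      ae_restrict_of_ae (L1loc.coeFn_sub y u),
      ae_restrict_of_ae (L1loc.coeFn_sub z u)] with x h1 h2 h3
    rw [h1, h2, h3, ← sub_sub_sub_cancel_right (y x) (z x) (u x)]
    exact enorm_sub_le
  · exact (y - u).aestronglyMeasurable.restrict.enorm

end Blend

/-! ### Polar decomposition and integration against vector measures. -/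

section Polar

variable {X : Type*} {mX : MeasurableSpace X} {ι : Type*} [Fintype ι]

/-- **Polar decomposition** of a vector measure of finite variation. -/
theorem exists_polar_decomposition (μ : VectorMeasure X (EuclideanSpace ℝ ι))
    [IsFiniteMeasure μ.variation] :
    ∃ g : X → EuclideanSpace ℝ ι, Integrable g μ.variation ∧
      μ = μ.variation.withDensityᵥ g ∧ ∀ᵐ x ∂μ.variation, ‖g x‖ = 1 := by
  let s : ι → SignedMeasure X := fun i =>
    μ.mapRange (EuclideanSpace.proj (𝕜 := ℝ) i : EuclideanSpace ℝ ι →L[ℝ] ℝ).toLinearMap.toAddMonoidHom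
      (EuclideanSpace.proj (𝕜 := ℝ) i : EuclideanSpace ℝ ι →L[ℝ] ℝ).continuous
  have hs : ∀ i A, s i A = μ A i := fun i A => rfl
  have hac : ∀ i, s i ≪ᵥ μ.variation.toENNRealVectorMeasure := by
    intro i
    refine VectorMeasure.AbsolutelyContinuous.mk fun A hA h => ?_
    rw [Measure.toENNRealVectorMeasure_apply_measurable hA] at h
    have : ‖μ A‖ₑ ≤ 0 := h ▸ VectorMeasure.enorm_measure_le_variation μ A
    have h0 : μ A = 0 := by simpa using this
    rw [hs, h0]; rfl
  have hd := fun i => SignedMeasure.withDensityᵥ_rnDeriv_eq (s i) μ.variation (hac i)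
  let g : X → EuclideanSpace ℝ ι := fun x => WithLp.toLp 2 fun i => (s i).rnDeriv μ.variation x
  have hint : ∀ i, Integrable ((s i).rnDeriv μ.variation) μ.variation := fun i =>
    SignedMeasure.integrable_rnDeriv _ _
  have hg : Integrable g μ.variation := by
    refine (PiLp.continuousLinearEquiv 2 ℝ (fun _ : ι => ℝ)).symm.toContinuousLinearMap.integrable_comp
      (φ := fun x i => (s i).rnDeriv μ.variation x) ?_
    exact Integrable.of_eval hint
  have hμ : μ = μ.variation.withDensityᵥ g := by
    ext A hA i
    rw [withDensityᵥ_apply hg hA, ← hs, ← hd i, withDensityᵥ_apply (hint i) hA]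
    exact (EuclideanSpace.proj (𝕜 := ℝ) i : EuclideanSpace ℝ ι →L[ℝ] ℝ).integral_comp_comm hg.integrableOn
  refine ⟨g, hg, hμ, ?_⟩
  -- The variation of a measure with density `g` has density `‖g‖`; here it is the reference measure
  -- itself, which forces `‖g‖ = 1`.
  have h1 : μ.variation.withDensity (fun x => ‖g x‖ₑ) = μ.variation.withDensity (fun _ => 1) := by
    rw [← Pi.one_def, withDensity_one, ← Measure.variation_withDensityᵥ hg, ← hμ]
  rw [withDensity_eq_iff_of_sigmaFinite hg.aestronglyMeasurable.enorm aemeasurable_const] at h1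
  filter_upwards [h1] with x hx
  simpa [enorm_eq_nnnorm, ← NNReal.coe_inj] using hx

/-- The integral of a scalar function against a vector measure with a density. -/
theorem integral_withDensityᵥ {E : Type*} [NormedAddCommGroup E] [NormedSpace ℝ E]
    [CompleteSpace E] {ν : Measure X} {g : X → E} (hg : Integrable g ν) {φ : X → ℝ}
    (hφ : Integrable φ (ν.withDensity fun x => ‖g x‖ₑ)) :
    (∫ᵛ x, φ x ∂•(ν.withDensityᵥ g)) = ∫ x, φ x • g x ∂ν := by
  have hg' : AEMeasurable (fun x => ‖g x‖₊) ν := hg.aestronglyMeasurable.nnnorm.aemeasurable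
  have : IsFiniteMeasure (ν.withDensity fun x => ‖g x‖ₑ) := ⟨by simpa using! hg.2⟩
  have hI : ∀ f : X → ℝ, Integrable f (ν.withDensity fun x => ‖g x‖ₑ) →
      Integrable (fun x => f x • g x) ν := by
    intro f hf
    have h1 : Integrable (fun x => ‖g x‖₊ • f x) ν :=
      (integrable_withDensity_iff_integrable_smul₀ hg').1 hf
    -- Multiplication by the bounded direction `‖g‖⁻¹ • g` turns `‖g‖ f` into `f g`; where `g = 0`
    -- both vanish.
    have h2 : Integrable (fun x => (‖g x‖₊ • f x) • (‖g x‖⁻¹ • g x)) ν := by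
      refine h1.smul_bdd 1
        (hg.aestronglyMeasurable.norm.inv₀.smul hg.aestronglyMeasurable) ?_
      filter_upwards with x using by simp [norm_smul, inv_mul_le_one]
    refine h2.congr (.of_forall fun x => ?_)
    rcases eq_or_ne (g x) 0 with hx | hx
    · simp [hx]
    · have : ‖g x‖ ≠ 0 := by simpa using hx
      simp only [NNReal.smul_def, smul_smul, coe_nnnorm, smul_eq_mul]
      congr 1
      field_simp
  have hv := Measure.variation_withDensityᵥ hg
  rw [← hv] at hφ hI this
  refine Integrable.induction (fun f => (∫ᵛ x, f x ∂•(ν.withDensityᵥ g)) = ∫ x, f x • g x ∂ν)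
    ?_ ?_ ?_ ?_ hφ
  · intro c s hs _
    rw [VectorMeasure.integral_indicator_const _ hs, withDensityᵥ_apply hg hs]
    have : (fun x => s.indicator (fun _ => c) x • g x) = s.indicator fun x => c • g x := by
      ext x
      by_cases hx : x ∈ s <;> simp [hx]
    rw [this, integral_indicator hs, integral_smul]
    rfl
  · intro f f' _ hf hf' h h'
    simp only [Pi.add_apply, add_smul]
    rw [integral_add (hI f hf) (hI f' hf'), VectorMeasure.integral_fun_add hf hf', h, h']
  · refine isClosed_eq VectorMeasure.continuous_integral ?_
    -- The right-hand side is 1-Lipschitz for the L¹ norm weighted by `‖g‖`, which is the L¹ norm of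
    -- the variation.
    refine LipschitzWith.continuous (K := 1) fun f f' => ?_
    have h1 := hI f (L1.integrable_coeFn f)
    have h2 := hI f' (L1.integrable_coeFn f')
    rw [edist_eq_enorm_sub, ← integral_sub h1 h2, ENNReal.coe_one, one_mul, L1.edist_def]
    refine (enorm_integral_le_lintegral_enorm _).trans ?_
    have h3 : AEMeasurable (fun x => edist (f x) (f' x)) (ν.withDensityᵥ g).variation :=
      (L1.aestronglyMeasurable_coeFn f).edist (L1.aestronglyMeasurable_coeFn f')
    have h4 : ∀ F : X → ℝ≥0∞, AEMeasurable F (ν.withDensityᵥ g).variation →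
        ∫⁻ x, F x ∂(ν.withDensityᵥ g).variation = ∫⁻ x, ‖g x‖ₑ * F x ∂ν := by
      intro F hF
      rw [hv] at hF ⊢
      exact lintegral_withDensity_eq_lintegral_mul₀' hg.aestronglyMeasurable.enorm hF
    rw [h4 _ h3]
    refine lintegral_mono fun x => ?_
    rw [← sub_smul, enorm_smul, edist_eq_enorm_sub, mul_comm]
  · intro f f' hff' hf h
    rw [← VectorMeasure.integral_congr_ae hff', h]
    apply integral_congr_ae
    rw [hv] at hff'
    filter_upwards [(ae_withDensity_iff' hg.aestronglyMeasurable.enorm).1 hff'] with x hx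
    by_cases hgx : g x = 0
    · simp [hgx]
    · rw [hx (by simpa using hgx)]

end Polar

/-! ### A Riesz theorem for vector fields: the dominating scalar measure. -/

section Riesz

open scoped CompactlySupported BoundedContinuousFunction

/-- **Hahn–Banach**, for a functional on a vector space dominated by the norm of a linear map. -/
theorem exists_dual_comp_eq {V E : Type*} [AddCommGroup V] [Module ℝ V] [NormedAddCommGroup E]
    [NormedSpace ℝ E] (Φ : V →ₗ[ℝ] E) (L : V →ₗ[ℝ] ℝ) {C : ℝ} (hC : 0 ≤ C)
    (hL : ∀ v, |L v| ≤ C * ‖Φ v‖) :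
    ∃ ℓ : E →L[ℝ] ℝ, ‖ℓ‖ ≤ C ∧ ∀ v, ℓ (Φ v) = L v := by
  obtain ⟨s, hs⟩ := Φ.rangeRestrict.exists_rightInverse_of_surjective Φ.range_rangeRestrict
  have hs' : ∀ p : LinearMap.range Φ, Φ (s p) = p := fun p =>
    congrArg Subtype.val (LinearMap.congr_fun hs p)
  let f : LinearMap.range Φ →L[ℝ] ℝ := (L.comp s).mkContinuous C fun p => by
    simpa [hs' p] using hL (s p)
  obtain ⟨ℓ, h1, h2⟩ := exists_extension_norm_eq _ f
  refine ⟨ℓ, h2 ▸ LinearMap.mkContinuous_norm_le _ hC _, fun v => ?_⟩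
  have h3 := h1 ⟨Φ v, LinearMap.mem_range_self Φ v⟩
  rw [h3]
  change L (s _) = L v
  -- The domination forces `L` to vanish on the kernel of `Φ`, so the choice of preimage is
  -- irrelevant.
  have h4 := hL (s ⟨Φ v, LinearMap.mem_range_self Φ v⟩ - v)
  rw [map_sub, map_sub, hs', sub_self, norm_zero, mul_zero] at h4
  exact sub_eq_zero.1 (abs_nonpos_iff.1 h4)

variable {X H : Type*} [TopologicalSpace X] [NormedAddCommGroup H] [NormedSpace ℝ H]

/-- The supremum of a functional over the fields dominated by a nonnegative function. -/
def dominatedSup (ℓ : (X →ᵇ H) →L[ℝ] ℝ) (φ : X → ℝ≥0) : ℝ≥0∞ :=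
  ⨆ (ψ : X →ᵇ H) (_ : ∀ x, ‖ψ x‖₊ ≤ φ x), ENNReal.ofReal (ℓ ψ)

variable (ℓ : (X →ᵇ H) →L[ℝ] ℝ)

theorem le_dominatedSup {φ : X → ℝ≥0} {ψ : X →ᵇ H} (h : ∀ x, ‖ψ x‖₊ ≤ φ x) :
    ENNReal.ofReal (ℓ ψ) ≤ dominatedSup ℓ φ :=
  le_iSup₂ (f := fun (ψ : X →ᵇ H) (_ : ∀ x, ‖ψ x‖₊ ≤ φ x) => ENNReal.ofReal (ℓ ψ)) ψ h

theorem dominatedSup_le {φ : X → ℝ≥0} {c : ℝ≥0} (h : ∀ x, φ x ≤ c) :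
    dominatedSup ℓ φ ≤ ENNReal.ofReal (‖ℓ‖ * c) := by
  refine iSup₂_le fun ψ hψ => ENNReal.ofReal_le_ofReal ?_
  refine (le_abs_self _).trans ((ℓ.le_opNorm ψ).trans ?_)
  gcongr
  exact (BoundedContinuousFunction.norm_le c.2).2 fun x => (hψ x).trans (h x)

/-- Split ψ in the proportions φ₁/(φ₁+φ₂) and φ₂/(φ₁+φ₂). The weights may be discontinuous where
φ₁+φ₂ vanishes, but ψ vanishes there too and squeezes both pieces to zero. -/
theorem exists_split {φ₁ φ₂ : X → ℝ≥0} (h₁ : Continuous φ₁) (h₂ : Continuous φ₂) (ψ : X →ᵇ H)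
    (h : ∀ x, ‖ψ x‖₊ ≤ φ₁ x + φ₂ x) :
    ∃ ψ₁ ψ₂ : X →ᵇ H, ψ = ψ₁ + ψ₂ ∧ (∀ x, ‖ψ₁ x‖₊ ≤ φ₁ x) ∧ ∀ x, ‖ψ₂ x‖₊ ≤ φ₂ x := by
  let f : X → H := fun x => (φ₁ x / (φ₁ x + φ₂ x)) • ψ x
  have hle : ∀ x, ‖f x‖ ≤ ‖ψ x‖ := fun x => by
    have : φ₁ x / (φ₁ x + φ₂ x) ≤ 1 := div_le_one_of_le₀ le_self_add zero_le
    simp only [f, NNReal.smul_def, norm_smul, NNReal.norm_eq]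
    exact mul_le_of_le_one_left (norm_nonneg _) (by exact_mod_cast this)
  have hf : Continuous f := by
    rw [continuous_iff_continuousAt]
    intro x
    by_cases hx : φ₁ x + φ₂ x = 0
    · have hψx : ψ x = 0 := by simpa [hx] using h x
      have h0 : f x = 0 := by simp [f, hψx]
      rw [ContinuousAt, h0]
      refine squeeze_zero_norm hle ?_
      simpa [hψx] using (ψ.continuous.norm.tendsto x)
    · exact ((h₁.continuousAt.div (h₁.add h₂).continuousAt hx)).smul ψ.continuous.continuousAt
  let ψ₁ : X →ᵇ H := BoundedContinuousFunction.ofNormedAddCommGroup f hf ‖ψ‖ fun x =>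
    (hle x).trans (ψ.norm_coe_le_norm x)
  refine ⟨ψ₁, ψ - ψ₁, by abel, fun x => ?_, fun x => ?_⟩
  · change ‖f x‖₊ ≤ _
    simp only [f, NNReal.smul_def, nnnorm_smul, NNReal.nnnorm_eq]
    rcases eq_or_ne (φ₁ x + φ₂ x) 0 with hx | hx
    · simp [hx]
    · calc φ₁ x / (φ₁ x + φ₂ x) * ‖ψ x‖₊ ≤ φ₁ x / (φ₁ x + φ₂ x) * (φ₁ x + φ₂ x) := by
            gcongr; exact h x
        _ = φ₁ x := div_mul_cancel₀ _ hx
  · change ‖ψ x - f x‖₊ ≤ _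
    rcases eq_or_ne (φ₁ x + φ₂ x) 0 with hx | hx
    · have hψx : ψ x = 0 := by simpa [hx] using h x
      simp [f, hψx]
    · have hx' : (φ₁ x : ℝ) + φ₂ x ≠ 0 := by exact_mod_cast hx
      have : ψ x - f x = (φ₂ x / (φ₁ x + φ₂ x)) • ψ x := by
        simp only [f, NNReal.smul_def, NNReal.coe_div, NNReal.coe_add]
        nth_rw 1 [← one_smul ℝ (ψ x)]
        rw [← sub_smul]
        congr 1
        field_simp
        ring
      rw [this, NNReal.smul_def, nnnorm_smul, NNReal.nnnorm_eq]
      calc φ₂ x / (φ₁ x + φ₂ x) * ‖ψ x‖₊ ≤ φ₂ x / (φ₁ x + φ₂ x) * (φ₁ x + φ₂ x) := by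
            gcongr; exact h x
        _ = φ₂ x := div_mul_cancel₀ _ hx

/-- Additivity is what allows the scalar Riesz–Markov–Kakutani theorem to be applied. A dominated
field splits, and conversely dominated fields add; fields with negative pairing contribute 0 and are
discarded. -/
theorem dominatedSup_add {φ₁ φ₂ : X → ℝ≥0} (h₁ : Continuous φ₁) (h₂ : Continuous φ₂) :
    dominatedSup ℓ (φ₁ + φ₂) = dominatedSup ℓ φ₁ + dominatedSup ℓ φ₂ := by
  apply le_antisymm
  · refine iSup₂_le fun ψ hψ => ?_
    obtain ⟨ψ₁, ψ₂, rfl, hψ₁, hψ₂⟩ := exists_split h₁ h₂ ψ hψ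
    rw [map_add]
    exact ENNReal.ofReal_add_le.trans
      (add_le_add (le_dominatedSup ℓ hψ₁) (le_dominatedSup ℓ hψ₂))
  · refine ENNReal.biSup_add_biSup_le' (p := fun ψ : X →ᵇ H => ∀ x, ‖ψ x‖₊ ≤ φ₁ x)
      (q := fun ψ : X →ᵇ H => ∀ x, ‖ψ x‖₊ ≤ φ₂ x) ⟨0, fun x => by simp⟩ ⟨0, fun x => by simp⟩
      fun ψ₁ hψ₁ ψ₂ hψ₂ => ?_
    rcases le_total (ℓ ψ₁) 0 with h | h
    · rw [ENNReal.ofReal_of_nonpos h, zero_add]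
      exact le_dominatedSup ℓ fun x => (hψ₂ x).trans le_add_self
    rcases le_total (ℓ ψ₂) 0 with h' | h'
    · rw [ENNReal.ofReal_of_nonpos h', add_zero]
      exact le_dominatedSup ℓ fun x => (hψ₁ x).trans le_self_add
    rw [← ENNReal.ofReal_add h h', ← map_add]
    exact le_dominatedSup ℓ fun x => (nnnorm_add_le _ _).trans (add_le_add (hψ₁ x) (hψ₂ x))

theorem mul_dominatedSup_le (c : ℝ≥0) (φ : X → ℝ≥0) :
    c * dominatedSup ℓ φ ≤ dominatedSup ℓ (c • φ) := by
  simp only [dominatedSup, ENNReal.mul_iSup]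
  refine iSup₂_le fun ψ hψ => ?_
  rw [← ENNReal.ofReal_coe_nnreal, ← ENNReal.ofReal_mul (NNReal.coe_nonneg c),
    ← smul_eq_mul, ← map_smul]
  refine le_dominatedSup ℓ fun x => ?_
  rw [BoundedContinuousFunction.coe_smul, nnnorm_smul, NNReal.nnnorm_eq]
  exact mul_le_mul_right (hψ x) c

theorem dominatedSup_smul (c : ℝ≥0) (φ : X → ℝ≥0) :
    dominatedSup ℓ (c • φ) = c * dominatedSup ℓ φ := by
  refine le_antisymm ?_ (mul_dominatedSup_le ℓ c φ)
  rcases eq_or_ne c 0 with rfl | hc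
  · simpa using dominatedSup_le ℓ (φ := (0 : ℝ≥0) • φ) (c := 0) (by simp)
  -- The reverse inequality is the same one for the factor `c⁻¹`.
  · have h := mul_dominatedSup_le ℓ c⁻¹ (c • φ)
    rw [smul_smul, inv_mul_cancel₀ hc, one_smul] at h
    have hc' : (c : ℝ≥0∞) ≠ 0 := by exact_mod_cast hc
    calc dominatedSup ℓ (c • φ) = c * ((c⁻¹ : ℝ≥0) * dominatedSup ℓ (c • φ)) := by
          rw [← mul_assoc, ENNReal.coe_inv hc, ENNReal.mul_inv_cancel hc' ENNReal.coe_ne_top,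
            one_mul]
      _ ≤ c * dominatedSup ℓ φ := by gcongr

theorem dominatedSup_ne_top (φ : C_c(X, ℝ≥0)) : dominatedSup ℓ φ ≠ ⊤ := by
  obtain ⟨c, hc⟩ := (φ.hasCompactSupport.comp_left (g := ((↑) : ℝ≥0 → ℝ))
    NNReal.coe_zero).exists_bound_of_continuous (by fun_prop)
  refine ((dominatedSup_le ℓ (c := c.toNNReal) fun x => ?_).trans_lt ENNReal.ofReal_lt_top).ne
  have h := hc x
  simp only [Function.comp_apply, NNReal.norm_eq] at h
  exact NNReal.le_toNNReal_of_coe_le h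

/-- The positive functional dominating a bounded functional on vector fields. -/
def dominatingFunctional : C_c(X, ℝ≥0) →ₗ[ℝ≥0] ℝ≥0 where
  toFun φ := (dominatedSup ℓ φ).toNNReal
  map_add' φ₁ φ₂ := by
    rw [CompactlySupportedContinuousMap.coe_add, dominatedSup_add ℓ (map_continuous φ₁) (map_continuous φ₂),
      ENNReal.toNNReal_add (dominatedSup_ne_top ℓ φ₁) (dominatedSup_ne_top ℓ φ₂)]
  map_smul' c φ := by
    rw [CompactlySupportedContinuousMap.coe_smul, dominatedSup_smul, ENNReal.toNNReal_mul]
    rfl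

theorem coe_dominatingFunctional (φ : C_c(X, ℝ≥0)) :
    (dominatingFunctional ℓ φ : ℝ≥0∞) = dominatedSup ℓ φ :=
  ENNReal.coe_toNNReal (dominatedSup_ne_top ℓ φ)

variable [T2Space X] [LocallyCompactSpace X] [MeasurableSpace X] [BorelSpace X]

/-- The field ψ is itself a competitor in the supremum taken at φ = ‖ψ‖. -/
theorem ofReal_le_lintegral_rieszMeasure {ψ : X →ᵇ H} (hψ : HasCompactSupport ψ) :
    ENNReal.ofReal (ℓ ψ) ≤ ∫⁻ x, ‖ψ x‖ₑ ∂(NNRealRMK.rieszMeasure (dominatingFunctional ℓ)) := by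
  let φ : C_c(X, ℝ≥0) := ⟨⟨fun x => ‖ψ x‖₊, by fun_prop⟩, hψ.comp_left nnnorm_zero⟩
  have h := NNRealRMK.lintegral_rieszMeasure (dominatingFunctional ℓ) φ
  rw [coe_dominatingFunctional] at h
  exact (le_dominatedSup ℓ (φ := φ) fun x => le_rfl).trans h.ge

/-- By inner regularity it suffices to test compact sets K. A cut-off equal to 1 on K bounds the
measure of K from above, and it dominates only fields of norm at most 1. -/
theorem rieszMeasure_univ_le :
    NNRealRMK.rieszMeasure (dominatingFunctional ℓ) Set.univ ≤ ENNReal.ofReal ‖ℓ‖ := by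
  rw [isOpen_univ.measure_eq_iSup_isCompact]
  refine iSup₂_le fun K _ => iSup_le fun hK => ?_
  obtain ⟨f, hf1, -, hfc, hf⟩ := exists_continuous_one_zero_of_isCompact hK isClosed_empty
    (Set.disjoint_empty K)
  let φ : C_c(X, ℝ≥0) := ⟨⟨fun x => Real.toNNReal (f x), by fun_prop⟩,
    hfc.comp_left Real.toNNReal_zero⟩
  have h := NNRealRMK.lintegral_rieszMeasure (dominatingFunctional ℓ) φ
  rw [coe_dominatingFunctional] at h
  calc NNRealRMK.rieszMeasure (dominatingFunctional ℓ) K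
      = ∫⁻ _ in K, 1 ∂(NNRealRMK.rieszMeasure (dominatingFunctional ℓ)) := by simp
    _ ≤ ∫⁻ x in K, φ x ∂(NNRealRMK.rieszMeasure (dominatingFunctional ℓ)) := by
        refine setLIntegral_mono' hK.measurableSet fun x hx => ?_
        have : φ x = 1 := by
          change Real.toNNReal (f x) = 1
          rw [hf1 hx]; simp
        simp [this]
    _ ≤ ∫⁻ x, φ x ∂(NNRealRMK.rieszMeasure (dominatingFunctional ℓ)) := setLIntegral_le_lintegral _ _
    _ = dominatedSup ℓ φ := h
    _ ≤ ENNReal.ofReal (‖ℓ‖ * (1 : ℝ≥0)) := dominatedSup_le ℓ fun x => by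
        change Real.toNNReal (f x) ≤ 1
        exact Real.toNNReal_le_one.2 (hf x).2
    _ = ENNReal.ofReal ‖ℓ‖ := by simp

end Riesz

/-! ### A Riesz theorem for vector fields: the density. -/

section RieszDensity

open scoped BoundedContinuousFunction

/-- A functional dominated by the integral of the norm against a finite measure has a density. -/
theorem exists_density_of_le_lintegral {X H : Type*} [MeasurableSpace X]
    [NormedAddCommGroup H] [InnerProductSpace ℝ H] [CompleteSpace H] (V : Submodule ℝ (X → H)) (ν : Measure X)
    [IsFiniteMeasure ν] (hmem : ∀ ψ : V, MemLp ψ.1 2 ν) (L : V →ₗ[ℝ] ℝ)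
    (hL : ∀ ψ : V, ENNReal.ofReal (L ψ) ≤ ∫⁻ x, ‖ψ.1 x‖ₑ ∂ν) :
    ∃ g : X → H, Integrable g ν ∧ ∫⁻ x, ‖g x‖ₑ ∂ν ≤ ν Set.univ ∧
      ∀ ψ : V, L ψ = ∫ x, inner ℝ (g x) (ψ.1 x) ∂ν := by
  let Ψ : V →ₗ[ℝ] Lp H 2 ν :=
    { toFun := fun ψ => (hmem ψ).toLp ψ.1
      map_add' := fun _ _ => rfl
      map_smul' := fun _ _ => rfl }
  -- `m` is the Cauchy–Schwarz constant between L¹ and L². It enters twice, in the L² bound for `L`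
  -- and in the L¹ bound for `g`, so the mass of `g` is at most `m * m = ν univ` and no constant is
  -- lost.
  obtain ⟨m, hm⟩ : ∃ m : ℝ≥0∞, m = ν Set.univ ^ (1 / 2 : ℝ) := ⟨_, rfl⟩
  have hm_top : m ≠ ⊤ :=
    hm ▸ ENNReal.rpow_ne_top_of_nonneg (by norm_num) (measure_ne_top _ _)
  have hmm : m * m = ν Set.univ := by
    rw [hm, ← ENNReal.rpow_add_of_nonneg _ _ (by norm_num) (by norm_num)]
    norm_num
  have hCS : ∀ f : X → H, AEStronglyMeasurable f ν → ∫⁻ x, ‖f x‖ₑ ∂ν ≤ eLpNorm f 2 ν * m := by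
    intro f hf
    have := eLpNorm_le_eLpNorm_mul_rpow_measure_univ (p := 1) (q := 2) (by norm_num) hf
    rw [eLpNorm_one_eq_lintegral_enorm] at this
    rw [hm]
    convert this using 3
    norm_num
  have hLΨ : ∀ ψ : V, L ψ ≤ m.toReal * ‖Ψ ψ‖ := by
    intro ψ
    have h0 : 0 ≤ m.toReal := ENNReal.toReal_nonneg
    have hn : ‖Ψ ψ‖ = (eLpNorm ψ.1 2 ν).toReal := Lp.norm_toLp _ (hmem ψ)
    rw [hn, ← ENNReal.ofReal_le_ofReal_iff (mul_nonneg h0 ENNReal.toReal_nonneg),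
      ENNReal.ofReal_mul h0, ENNReal.ofReal_toReal hm_top,
      ENNReal.ofReal_toReal (hmem ψ).eLpNorm_ne_top, mul_comm]
    exact (hL ψ).trans (hCS ψ.1 (hmem ψ).aestronglyMeasurable)
  obtain ⟨ℓ, hℓ, hℓL⟩ := exists_dual_comp_eq Ψ L (C := m.toReal) ENNReal.toReal_nonneg fun ψ =>
    abs_le'.2 ⟨hLΨ ψ, by simpa using hLΨ (-ψ)⟩
  obtain ⟨g, hg⟩ : ∃ g : Lp H 2 ν, g = (InnerProductSpace.toDual ℝ (Lp H 2 ν)).symm ℓ := ⟨_, rfl⟩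
  have hgm : MemLp g 2 ν := Lp.memLp g
  refine ⟨g, hgm.integrable (by norm_num), ?_, fun ψ => ?_⟩
  · refine (hCS g hgm.aestronglyMeasurable).trans ?_
    have : eLpNorm g 2 ν ≤ m := by
      have h1 : ‖g‖ ≤ m.toReal := by
        rw [hg, LinearIsometryEquiv.norm_map]; exact hℓ
      rw [Lp.norm_def] at h1
      exact (ENNReal.toReal_le_toReal hgm.eLpNorm_ne_top hm_top).1 h1
    calc eLpNorm g 2 ν * m ≤ m * m := by gcongr
      _ = ν Set.univ := hmm
  · have h1 : L ψ = inner ℝ g (Ψ ψ) := by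
      rw [← hℓL, hg, InnerProductSpace.toDual_symm_apply]
    rw [h1, L2.inner_def]
    apply integral_congr_ae
    filter_upwards [(hmem ψ).coeFn_toLp] with x hx
    change inner ℝ (g x) ((hmem ψ).toLp ψ.1 x) = _
    rw [hx]

variable {X H : Type*} [TopologicalSpace X] [T2Space X] [LocallyCompactSpace X]
  [MeasurableSpace X] [BorelSpace X] [NormedAddCommGroup H] [InnerProductSpace ℝ H]

/-- A bounded functional on a space of compactly supported continuous fields is dominated by the
integral of the norm against a finite measure. -/
theorem exists_dominating_measure (V : Submodule ℝ (X → H)) (hc : ∀ ψ ∈ V, Continuous ψ)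
    (hs : ∀ ψ ∈ V, HasCompactSupport ψ) (L : V →ₗ[ℝ] ℝ) (C : ℝ≥0)
    (hL : ∀ ψ : V, (∀ x, ‖ψ.1 x‖ ≤ 1) → L ψ ≤ C) :
    ∃ ν : Measure X, ν Set.univ ≤ C ∧ IsFiniteMeasureOnCompacts ν ∧
      ∀ ψ : V, ENNReal.ofReal (L ψ) ≤ ∫⁻ x, ‖ψ.1 x‖ₑ ∂ν := by
  have hbd : ∀ ψ : V, ∃ M, ∀ x, ‖ψ.1 x‖ ≤ M := fun ψ =>
    (hs ψ.1 ψ.2).exists_bound_of_continuous (hc ψ.1 ψ.2)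
  let Φ : V →ₗ[ℝ] (X →ᵇ H) :=
    { toFun := fun ψ => BoundedContinuousFunction.ofNormedAddCommGroup ψ.1 (hc ψ.1 ψ.2)
        (hbd ψ).choose (hbd ψ).choose_spec
      map_add' := fun _ _ => rfl
      map_smul' := fun _ _ => rfl }
  have hΦ : ∀ (ψ : V) x, Φ ψ x = ψ.1 x := fun _ _ => rfl
  have hL' : ∀ ψ : V, L ψ ≤ C * ‖Φ ψ‖ := by
    intro ψ
    rcases eq_or_ne ‖Φ ψ‖ 0 with h0 | h0
    · have : ψ = 0 := by
        ext x
        rw [← hΦ, norm_eq_zero.1 h0]; rfl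
      simp [this]
    · have h := hL (‖Φ ψ‖⁻¹ • ψ) fun x => by
        change ‖‖Φ ψ‖⁻¹ • ψ.1 x‖ ≤ 1
        rw [norm_smul, norm_inv, norm_norm, ← hΦ]
        exact inv_mul_le_one_of_le₀ ((Φ ψ).norm_coe_le_norm x) (norm_nonneg _)
      rw [map_smul, smul_eq_mul, inv_mul_le_iff₀ (lt_of_le_of_ne (norm_nonneg _) h0.symm)] at h
      linarith
  obtain ⟨ℓ, hℓ, hℓL⟩ := exists_dual_comp_eq Φ L C.2 fun ψ => abs_le'.2 ⟨hL' ψ, by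
    simpa using hL' (-ψ)⟩
  refine ⟨NNRealRMK.rieszMeasure (dominatingFunctional ℓ), (rieszMeasure_univ_le ℓ).trans ?_,
    inferInstance, fun ψ => ?_⟩
  · rw [← ENNReal.ofReal_coe_nnreal]; exact ENNReal.ofReal_le_ofReal hℓ
  · rw [← hℓL]
    exact ofReal_le_lintegral_rieszMeasure ℓ (ψ := Φ ψ) (hs ψ.1 ψ.2)

/-- A bounded functional on a space of compactly supported continuous fields is the integral
against a finite vector measure, whose mass is at most the norm of the functional. -/
theorem exists_density [CompleteSpace H] [SecondCountableTopology H] (V : Submodule ℝ (X → H)) (hc : ∀ ψ ∈ V, Continuous ψ)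
    (hs : ∀ ψ ∈ V, HasCompactSupport ψ) (L : V →ₗ[ℝ] ℝ) (C : ℝ≥0)
    (hL : ∀ ψ : V, (∀ x, ‖ψ.1 x‖ ≤ 1) → L ψ ≤ C) :
    ∃ (ν : Measure X) (g : X → H), IsFiniteMeasure ν ∧ Integrable g ν ∧ ∫⁻ x, ‖g x‖ₑ ∂ν ≤ C ∧
      ∀ ψ : V, L ψ = ∫ x, inner ℝ (g x) (ψ.1 x) ∂ν := by
  obtain ⟨ν, hνC, _, hν⟩ := exists_dominating_measure V hc hs L C hL
  have hfin : IsFiniteMeasure ν := ⟨hνC.trans_lt ENNReal.coe_lt_top⟩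
  obtain ⟨g, hg, hgν, hgL⟩ := exists_density_of_le_lintegral V ν
    (fun ψ => (hc ψ.1 ψ.2).memLp_of_hasCompactSupport (hs ψ.1 ψ.2)) L hν
  exact ⟨ν, g, hfin, hg, hgν.trans hνC, hgL⟩

end RieszDensity

/-! ### Matrix test fields and the distributional pairing with Eu. -/

section Tests

variable {d : ℕ}

/-- The linear map expressing the symmetrized divergence of a matrix field through its
derivative. -/
def symDivL (d : ℕ) : (Rd d →L[ℝ] Rdd d) →L[ℝ] Rd d :=
  LinearMap.toContinuousLinearMap
    { toFun := fun D => ∑ i : Fin d, ∑ j : Fin d,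
        (1 / 2 : ℝ) • (D (EuclideanSpace.single j 1) (i, j) • EuclideanSpace.single i (1 : ℝ) +
          D (EuclideanSpace.single i 1) (i, j) • EuclideanSpace.single j (1 : ℝ))
      map_add' := fun D D' => by
        simp only [← Finset.sum_add_distrib]
        refine Finset.sum_congr rfl fun i _ => Finset.sum_congr rfl fun j _ => ?_
        simp only [add_apply, PiLp.add_apply]
        module
      map_smul' := fun c D => by
        simp only [Finset.smul_sum]
        refine Finset.sum_congr rfl fun i _ => Finset.sum_congr rfl fun j _ => ?_
        simp only [smul_apply, PiLp.smul_apply, RingHom.id_apply, smul_eq_mul]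
        module }

theorem symDivL_apply (D : Rd d →L[ℝ] Rdd d) : symDivL d D = ∑ i : Fin d, ∑ j : Fin d,
    (1 / 2 : ℝ) • (D (EuclideanSpace.single j 1) (i, j) • EuclideanSpace.single i (1 : ℝ) +
      D (EuclideanSpace.single i 1) (i, j) • EuclideanSpace.single j (1 : ℝ)) := rfl

/-- The smooth matrix fields with compact support in `U`. -/
def testFields (U : Set (Rd d)) : Submodule ℝ (Rd d → Rdd d) where
  carrier := {ψ | ContDiff ℝ ∞ ψ ∧ HasCompactSupport ψ ∧ tsupport ψ ⊆ U}
  zero_mem' := ⟨contDiff_const, HasCompactSupport.zero, by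
    rw [tsupport_eq_empty_iff.2 rfl]; exact Set.empty_subset _⟩
  add_mem' := fun h h' => ⟨h.1.add h'.1, h.2.1.add h'.2.1,
    (tsupport_add _ _).trans (Set.union_subset h.2.2 h'.2.2)⟩
  smul_mem' := fun c ψ h => ⟨contDiff_const.smul h.1, h.2.1.smul_left (f := fun _ => c),
    (tsupport_smul_subset_right (fun _ => c) ψ).trans h.2.2⟩

theorem testFields_mono {U V : Set (Rd d)} (h : U ⊆ V) : testFields U ≤ testFields V :=
  fun _ hψ => ⟨hψ.1, hψ.2.1, hψ.2.2.trans h⟩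

/-- The symmetrized divergence of a matrix field. -/
def symDiv (ψ : Rd d → Rdd d) (x : Rd d) : Rd d := symDivL d (fderiv ℝ ψ x)

theorem continuous_symDiv {ψ : Rd d → Rdd d} (h : ContDiff ℝ ∞ ψ) : Continuous (symDiv ψ) :=
  (symDivL d).continuous.comp (h.continuous_fderiv (by simp))

theorem tsupport_symDiv_subset (ψ : Rd d → Rdd d) : tsupport (symDiv ψ) ⊆ tsupport ψ :=
  (closure_mono (Function.support_comp_subset (map_zero (symDivL d)) _)).trans
    (tsupport_fderiv_subset ℝ)

theorem hasCompactSupport_symDiv {ψ : Rd d → Rdd d} (h : HasCompactSupport ψ) :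
    HasCompactSupport (symDiv ψ) :=
  h.of_isClosed_subset (isClosed_tsupport _) (tsupport_symDiv_subset ψ)

theorem symDiv_add {ψ ψ' : Rd d → Rdd d} (h : ContDiff ℝ ∞ ψ) (h' : ContDiff ℝ ∞ ψ') :
    symDiv (ψ + ψ') = symDiv ψ + symDiv ψ' := by
  ext1 x
  simp only [symDiv, Pi.add_apply]
  rw [fderiv_add (h.differentiable (by simp) x) (h'.differentiable (by simp) x), map_add]

theorem symDiv_const_smul {ψ : Rd d → Rdd d} (h : ContDiff ℝ ∞ ψ) (c : ℝ) :
    symDiv (c • ψ) = c • symDiv ψ := by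
  ext1 x
  simp only [symDiv, Pi.smul_apply]
  rw [fderiv_const_smul (h.differentiable (by simp) x), map_smul]

theorem symDiv_smul {φ : Rd d → ℝ} {ψ : Rd d → Rdd d} (hφ : ContDiff ℝ ∞ φ)
    (h : ContDiff ℝ ∞ ψ) (x : Rd d) :
    symDiv (fun x => φ x • ψ x) x =
      φ x • symDiv ψ x + symDivL d ((fderiv ℝ φ x).smulRight (ψ x)) := by
  simp only [symDiv]
  rw [fderiv_fun_smul (hφ.differentiable (by simp) x) (h.differentiable (by simp) x), map_add,
    map_smul]

theorem integrable_inner_of_hasCompactSupport (u : L1loc d) {w : Rd d → Rd d}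
    (hw : Continuous w) (hws : HasCompactSupport w) :
    Integrable (fun x => inner ℝ (u x) (w x)) volume := by
  obtain ⟨M, hM⟩ := hws.exists_bound_of_continuous hw
  have hK : IsCompact (tsupport w) := hws
  rw [← integrableOn_iff_integrable_of_support_subset (s := tsupport w)]
  · refine ((u.locallyIntegrable.integrableOn_isCompact hK).norm.mul_const M).mono'
      (u.aestronglyMeasurable.restrict.inner hw.aestronglyMeasurable) (.of_forall fun x => ?_)
    exact (norm_inner_le_norm _ _).trans (mul_le_mul_of_nonneg_left (hM x) (norm_nonneg _))
  · intro x hx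
    refine subset_tsupport _ fun h => hx ?_
    simp [h]

theorem integrable_inner_symDiv (u : L1loc d) {U : Set (Rd d)} {ψ : Rd d → Rdd d}
    (h : ψ ∈ testFields U) : Integrable (fun x => inner ℝ (u x) (symDiv ψ x)) volume :=
  integrable_inner_of_hasCompactSupport u (continuous_symDiv h.1) (hasCompactSupport_symDiv h.2.1)

/-- The distributional symmetric gradient of `u`, as a functional on test fields. -/
def symPairing (u : L1loc d) (U : Set (Rd d)) : testFields U →ₗ[ℝ] ℝ where
  toFun ψ := -∫ x, inner ℝ (u x) (symDiv ψ.1 x)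
  map_add' ψ ψ' := by
    change -∫ x, inner ℝ (u x) (symDiv (ψ.1 + ψ'.1) x) = _
    rw [symDiv_add ψ.2.1 ψ'.2.1]
    simp only [Pi.add_apply, inner_add_right]
    rw [integral_add (integrable_inner_symDiv u ψ.2) (integrable_inner_symDiv u ψ'.2), neg_add]
  map_smul' c ψ := by
    change -∫ x, inner ℝ (u x) (symDiv (c • ψ.1) x) = _
    rw [symDiv_const_smul ψ.2.1]
    simp only [Pi.smul_apply, inner_smul_right, integral_const_mul, RingHom.id_apply, smul_eq_mul]
    ring

theorem symPairing_apply (u : L1loc d) {U : Set (Rd d)} (ψ : testFields U) :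
    symPairing u U ψ = -∫ x, inner ℝ (u x) (symDiv ψ.1 x) := rfl

/-- The scalar test function `φ` placed in the entry `(i, j)`. -/
def entryField {U : Set (Rd d)} {φ : Rd d → ℝ} (h1 : ContDiff ℝ ∞ φ) (h2 : HasCompactSupport φ)
    (h3 : tsupport φ ⊆ U) (i j : Fin d) : testFields U :=
  ⟨fun x => φ x • EuclideanSpace.single (i, j) (1 : ℝ), h1.smul contDiff_const,
    h2.smul_right (f' := fun _ => EuclideanSpace.single (i, j) (1 : ℝ)),
    (tsupport_smul_subset_left φ fun _ => EuclideanSpace.single (i, j) (1 : ℝ)).trans h3⟩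

/-- With a single nonzero entry, only one term of the symmetrized divergence survives; this connects
the duality pairing with the componentwise identity in `IsSymGradient`. -/
theorem symPairing_entryField (u : L1loc d) {U : Set (Rd d)} {φ : Rd d → ℝ} (h1 : ContDiff ℝ ∞ φ)
    (h2 : HasCompactSupport φ) (h3 : tsupport φ ⊆ U) (i j : Fin d) :
    symPairing u U (entryField h1 h2 h3 i j) =
      -∫ x, (1 / 2 : ℝ) * (u x i * fderiv ℝ φ x (EuclideanSpace.single j 1) +
        u x j * fderiv ℝ φ x (EuclideanSpace.single i 1)) := by
  rw [symPairing_apply]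
  congr 1
  refine integral_congr_ae (.of_forall fun x => ?_)
  have hd : fderiv ℝ (entryField h1 h2 h3 i j).1 x =
      (fderiv ℝ φ x).smulRight (EuclideanSpace.single (i, j) (1 : ℝ)) := by
    simp only [entryField]
    rw [fderiv_smul_const (h1.differentiable (by simp) x)]
  simp only [symDiv, hd, symDivL_apply, ContinuousLinearMap.smulRight_apply, PiLp.smul_apply,
    inner_sum, inner_smul_right, inner_add_right, EuclideanSpace.inner_single_right]
  rw [Finset.sum_eq_single i, Finset.sum_eq_single j]
  · simp
    ring
  · intro j' _ hj'
    simp [hj']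
  · simp
  · intro i' _ hi'
    refine Finset.sum_eq_zero fun j' _ => ?_
    simp [hi']
  · simp

/-- Reduces matrix test fields to the scalar test functions used in `IsSymGradient`. -/
theorem eq_sum_entryField {U : Set (Rd d)} (ψ : testFields U) :
    ∃ (h1 : ∀ i j, ContDiff ℝ ∞ fun x => ψ.1 x (i, j))
      (h2 : ∀ i j, HasCompactSupport fun x => ψ.1 x (i, j))
      (h3 : ∀ i j, (tsupport fun x => ψ.1 x (i, j)) ⊆ U),
      ψ = ∑ i : Fin d, ∑ j : Fin d, entryField (h1 i j) (h2 i j) (h3 i j) i j := by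
  refine ⟨fun i j => contDiff_euclidean.1 ψ.2.1 (i, j),
    fun i j => ψ.2.2.1.comp_left (g := fun A : Rdd d => A (i, j)) rfl,
    fun i j => (closure_mono (Function.support_comp_subset (g := fun A : Rdd d => A (i, j)) rfl _)).trans ψ.2.2.2, ?_⟩
  ext x ⟨k, l⟩
  simp only [Submodule.coe_sum, Finset.sum_apply, WithLp.ofLp_sum, entryField, PiLp.smul_apply]
  rw [Finset.sum_eq_single k, Finset.sum_eq_single l]
  · simp
  · intro j' _ hj'
    simp [hj'.symm]
  · simp
  · intro i' _ hi'
    refine Finset.sum_eq_zero fun j' _ => ?_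
    simp [hi'.symm]
  · simp

end Tests

/-! ### Identification of the dual total variation with |Eu|. -/

section SymGradient

variable {d : ℕ}

theorem integral_withDensityᵥ_apply {ν : Measure (Rd d)} {g : Rd d → Rdd d} (hg : Integrable g ν)
    {φ : Rd d → ℝ} (hφ : Continuous φ) (hφs : HasCompactSupport φ) (i j : Fin d) :
    (∫ᵛ x, φ x ∂•(ν.withDensityᵥ g)) (i, j) = ∫ x, φ x * g x (i, j) ∂ν := by
  have : IsFiniteMeasure (ν.withDensity fun x => ‖g x‖ₑ) := ⟨by simpa using! hg.2⟩
  obtain ⟨M, hM⟩ := hφs.exists_bound_of_continuous hφ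
  rw [integral_withDensityᵥ hg (hφ.integrable_of_hasCompactSupport hφs)]
  have h1 : Integrable (fun x => φ x • g x) ν :=
    hg.bdd_smul M hφ.aestronglyMeasurable (.of_forall hM)
  exact ((EuclideanSpace.proj (𝕜 := ℝ) (i, j) : Rdd d →L[ℝ] ℝ).integral_comp_comm h1).symm

theorem integrable_inner_testField {ν : Measure (Rd d)} {g : Rd d → Rdd d}
    (hg : Integrable g ν) {U : Set (Rd d)} (ψ : testFields U) :
    Integrable (fun x => inner ℝ (g x) (ψ.1 x)) ν := by
  obtain ⟨M, hM⟩ := ψ.2.2.1.exists_bound_of_continuous ψ.2.1.continuous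
  refine (hg.norm.mul_const M).mono'
    (hg.aestronglyMeasurable.inner ψ.2.1.continuous.aestronglyMeasurable) (.of_forall fun x => ?_)
  exact (norm_inner_le_norm _ _).trans (mul_le_mul_of_nonneg_left (hM x) (norm_nonneg _))

theorem integral_inner_entryField {ν : Measure (Rd d)} (g : Rd d → Rdd d)
    {U : Set (Rd d)} {φ : Rd d → ℝ} (h1 : ContDiff ℝ ∞ φ)
    (h2 : HasCompactSupport φ) (h3 : tsupport φ ⊆ U) (i j : Fin d) :
    ∫ x, inner ℝ (g x) ((entryField h1 h2 h3 i j).1 x) ∂ν = ∫ x, φ x * g x (i, j) ∂ν := by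
  refine integral_congr_ae (.of_forall fun x => ?_)
  simp [entryField, inner_smul_right, EuclideanSpace.inner_single_right]

theorem symPairing_eq_of_isSymGradient {u : L1loc d} {U : Set (Rd d)} {ν : Measure (Rd d)}
    {g : Rd d → Rdd d} (hg : Integrable g ν) (h : IsSymGradient u U (ν.withDensityᵥ g))
    (ψ : testFields U) : symPairing u U ψ = ∫ x, inner ℝ (g x) (ψ.1 x) ∂ν := by
  obtain ⟨h1, h2, h3, hψ⟩ := eq_sum_entryField ψ
  have hR : ∫ x, inner ℝ (g x) (ψ.1 x) ∂ν =
      ∑ i, ∑ j, ∫ x, inner ℝ (g x) ((entryField (h1 i j) (h2 i j) (h3 i j) i j).1 x) ∂ν := by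
    have : ∀ x, inner ℝ (g x) (ψ.1 x) =
        ∑ i, ∑ j, inner ℝ (g x) ((entryField (h1 i j) (h2 i j) (h3 i j) i j).1 x) := by
      intro x
      nth_rw 1 [hψ]
      simp only [Submodule.coe_sum, Finset.sum_apply, inner_sum]
    simp only [this]
    rw [integral_finsetSum _ fun i _ => integrable_finsetSum _ fun j _ =>
      integrable_inner_testField hg _]
    exact Finset.sum_congr rfl fun i _ => integral_finsetSum _ fun j _ =>
      integrable_inner_testField hg _
  rw [hR]
  nth_rw 1 [hψ]
  rw [map_sum]
  refine Finset.sum_congr rfl fun i _ => ?_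
  rw [map_sum]
  refine Finset.sum_congr rfl fun j _ => ?_
  rw [symPairing_entryField, integral_inner_entryField, ← h.eq _ (h1 i j) (h2 i j) (h3 i j),
    integral_withDensityᵥ_apply hg (h1 i j).continuous (h2 i j)]

/-- The total variation of the symmetric gradient of `u` on `U`, defined by duality. -/
def totalVar (u : L1loc d) (U : Set (Rd d)) : ℝ≥0∞ :=
  ⨆ (ψ : testFields U) (_ : ∀ x, ‖ψ.1 x‖ ≤ 1), ENNReal.ofReal (symPairing u U ψ)

theorem le_totalVar (u : L1loc d) {U : Set (Rd d)} (ψ : testFields U) (h : ∀ x, ‖ψ.1 x‖ ≤ 1) :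
    ENNReal.ofReal (symPairing u U ψ) ≤ totalVar u U :=
  le_iSup₂ (f := fun (ψ : testFields U) (_ : ∀ x, ‖ψ.1 x‖ ≤ 1) =>
    ENNReal.ofReal (symPairing u U ψ)) ψ h

/-- The polar density has norm one, so Cauchy–Schwarz bounds the integrand by 1 on U, and test
fields vanish off U. -/
theorem totalVar_le_variation {u : L1loc d} {U : Set (Rd d)} (hU : IsOpen U)
    {μ : VectorMeasure (Rd d) (Rdd d)} (h : IsSymGradient u U μ) :
    totalVar u U ≤ μ.variation U := by
  have : IsFiniteMeasure μ.variation := ⟨h.bounded⟩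
  obtain ⟨g, hg, hμ, hg1⟩ := exists_polar_decomposition μ
  refine iSup₂_le fun ψ hψ => ?_
  rw [symPairing_eq_of_isSymGradient hg (hμ ▸ h)]
  calc ENNReal.ofReal (∫ x, inner ℝ (g x) (ψ.1 x) ∂μ.variation)
      ≤ ‖∫ x, inner ℝ (g x) (ψ.1 x) ∂μ.variation‖ₑ := Real.ofReal_le_enorm _
    _ ≤ ∫⁻ x, ‖(inner ℝ (g x) (ψ.1 x) : ℝ)‖ₑ ∂μ.variation := enorm_integral_le_lintegral_enorm _
    _ ≤ ∫⁻ x, U.indicator 1 x ∂μ.variation := by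
        apply lintegral_mono_ae
        filter_upwards [hg1] with x hx
        by_cases hxU : x ∈ U
        · rw [Set.indicator_of_mem hxU, Pi.one_apply, ← ofReal_norm]
          refine ENNReal.ofReal_le_one.2 ((norm_inner_le_norm _ _).trans ?_)
          rw [hx, one_mul]; exact hψ x
        · have : ψ.1 x = 0 := image_eq_zero_of_notMem_tsupport fun h => hxU (ψ.2.2.2 h)
          simp [this]
    _ = μ.variation U := lintegral_indicator_one hU.measurableSet

/-- Both measures have the same integrals against test functions on U, so the polar density of the
difference vanishes almost everywhere on U. It also has norm one, hence U is null. -/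
theorem variation_sub_eq_zero {u : L1loc d} {U : Set (Rd d)} (hU : IsOpen U)
    {μ μ' : VectorMeasure (Rd d) (Rdd d)} (h : IsSymGradient u U μ) (h' : IsSymGradient u U μ') :
    (μ - μ').variation U = 0 := by
  have : IsFiniteMeasure μ.variation := ⟨h.bounded⟩
  have : IsFiniteMeasure μ'.variation := ⟨h'.bounded⟩
  have hfin : IsFiniteMeasure (μ - μ').variation :=
    ⟨(VectorMeasure.variation_sub_le Set.univ).trans_lt (ENNReal.add_lt_top.2 ⟨h.bounded, h'.bounded⟩)⟩
  obtain ⟨g, hg, hμ, hg1⟩ := exists_polar_decomposition (μ - μ')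
  have hz : ∀ i j, ∀ᵐ x ∂(μ - μ').variation, x ∈ U → g x (i, j) = 0 := by
    intro i j
    have hgi : Integrable (fun x => g x (i, j)) (μ - μ').variation :=
      (EuclideanSpace.proj (𝕜 := ℝ) (i, j) : Rdd d →L[ℝ] ℝ).integrable_comp hg
    refine hU.ae_eq_zero_of_integral_contDiff_smul_eq_zero
      (hgi.locallyIntegrable.locallyIntegrableOn U) fun φ h1 h2 h3 => ?_
    have h4 := integral_withDensityᵥ_apply hg h1.continuous h2 i j
    rw [← hμ, VectorMeasure.integral_sub_vectorMeasure
      (h1.continuous.integrable_of_hasCompactSupport h2)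
      (h1.continuous.integrable_of_hasCompactSupport h2), PiLp.sub_apply,
      h.eq φ h1 h2 h3, h'.eq φ h1 h2 h3, sub_self] at h4
    exact h4.symm
  have hU0 : ∀ᵐ x ∂(μ - μ').variation, x ∉ U := by
    filter_upwards [hg1, ae_all_iff.2 fun i => ae_all_iff.2 (hz i)] with x hx hx' hxU
    have : g x = 0 := by
      ext ⟨i, j⟩
      exact hx' i j hxU
    simp [this] at hx
  simpa [ae_iff] using hU0

/-- The two measures agree on every Borel subset of U. Exchanging their roles gives equality. -/
theorem variation_eq_of_isSymGradient {u : L1loc d} {U : Set (Rd d)} (hU : IsOpen U)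
    {μ μ' : VectorMeasure (Rd d) (Rdd d)} (h : IsSymGradient u U μ) (h' : IsSymGradient u U μ') :
    μ.variation U ≤ μ'.variation U := by
  refine VectorMeasure.variation_apply_le_of_forall_enorm_le hU.measurableSet fun A _ hAU => ?_
  have h0 : ‖(μ - μ') A‖ₑ ≤ 0 := (VectorMeasure.enorm_measure_le_variation _ A).trans
    ((measure_mono hAU).trans (variation_sub_eq_zero hU h h').le)
  have : μ A = μ' A := sub_eq_zero.1 (by simpa using h0)
  rw [this]
  exact VectorMeasure.enorm_measure_le_variation _ A

theorem exists_isSymGradient {u : L1loc d} {U : Set (Rd d)} (h : totalVar u U ≠ ⊤) :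
    ∃ μ, IsSymGradient u U μ ∧ μ.variation Set.univ ≤ totalVar u U := by
  obtain ⟨ν, g, _, hg, hgC, hL⟩ := exists_density (testFields U) (fun ψ hψ => hψ.1.continuous)
    (fun ψ hψ => hψ.2.1) (symPairing u U) (totalVar u U).toNNReal (fun ψ hψ => by
      have := le_totalVar u ψ hψ
      rw [← ENNReal.coe_toNNReal h, ← ENNReal.ofReal_coe_nnreal] at this
      exact (ENNReal.ofReal_le_ofReal_iff (NNReal.coe_nonneg _)).1 this)
  rw [ENNReal.coe_toNNReal h] at hgC
  have hvar : (ν.withDensityᵥ g).variation Set.univ ≤ totalVar u U := by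
    rw [Measure.variation_withDensityᵥ hg, withDensity_apply _ MeasurableSet.univ]
    simpa using hgC
  refine ⟨ν.withDensityᵥ g, ⟨hvar.trans_lt h.lt_top, fun φ h1 h2 h3 i j => ?_⟩, hvar⟩
  rw [integral_withDensityᵥ_apply hg h1.continuous h2, ← symPairing_entryField u h1 h2 h3,
    hL, integral_inner_entryField]

/-- The Riesz theorem produces one representing measure of mass at most `totalVar u U`; by
uniqueness every other one has the same variation on U. -/
theorem variation_eq_totalVar {u : L1loc d} {U : Set (Rd d)} (hU : IsOpen U)
    {μ : VectorMeasure (Rd d) (Rdd d)} (h : IsSymGradient u U μ) :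
    μ.variation U = totalVar u U := by
  refine le_antisymm ?_ (totalVar_le_variation hU h)
  by_cases hT : totalVar u U = ⊤
  · rw [hT]; exact le_top
  obtain ⟨μ', h', hμ'⟩ := exists_isSymGradient hT
  exact (variation_eq_of_isSymGradient hU h h').trans ((measure_mono (Set.subset_univ U)).trans hμ')

theorem L1loc.integrableOn_of_isBounded (u : L1loc d) {U : Set (Rd d)}
    (hU : Bornology.IsBounded U) : IntegrableOn u U volume :=
  (u.locallyIntegrable.integrableOn_isCompact hU.isCompact_closure).mono_set subset_closure

theorem isBD_iff {u : L1loc d} {U : Set (Rd d)} (hU : IsOpen U) (hb : Bornology.IsBounded U) :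
    IsBD u U ↔ totalVar u U ≠ ⊤ := by
  refine ⟨fun ⟨_, μ, hμ⟩ => ?_, fun h => ?_⟩
  · rw [← variation_eq_totalVar hU hμ]
    exact ((measure_mono (Set.subset_univ U)).trans_lt hμ.bounded).ne
  · obtain ⟨μ, hμ, -⟩ := exists_isSymGradient h
    exact ⟨u.integrableOn_of_isBounded hb, μ, hμ⟩

end SymGradient

/-! ### Superadditivity, tightness, semicontinuity and product rule for the total variation. -/

section TotalVar

variable {d : ℕ}

/-- A test field on `U`, regarded as a test field on a larger set. -/
def inclTest {U V : Set (Rd d)} (h : U ⊆ V) (ψ : testFields U) : testFields V :=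
  ⟨ψ.1, testFields_mono h ψ.2⟩

theorem totalVar_mono (u : L1loc d) {U V : Set (Rd d)} (h : U ⊆ V) :
    totalVar u U ≤ totalVar u V :=
  iSup₂_le fun ψ hψ => le_totalVar u (inclTest h ψ) hψ

theorem norm_add_le_one_of_disjoint {ψ ψ' : Rd d → Rdd d} {A B : Set (Rd d)}
    (hA : tsupport ψ ⊆ A) (hB : tsupport ψ' ⊆ B) (hAB : Disjoint A B)
    (h : ∀ x, ‖ψ x‖ ≤ 1) (h' : ∀ x, ‖ψ' x‖ ≤ 1) (x : Rd d) : ‖ψ x + ψ' x‖ ≤ 1 := by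
  by_cases hx : x ∈ A
  · rw [image_eq_zero_of_notMem_tsupport fun hx' => Set.disjoint_left.1 hAB hx (hB hx'), add_zero]
    exact h x
  · rw [image_eq_zero_of_notMem_tsupport fun hx' => hx (hA hx'), zero_add]
    exact h' x

/-- Test fields supported in disjoint sets may be added without exceeding norm 1. -/
theorem totalVar_add_le (u : L1loc d) {A B W : Set (Rd d)} (hAB : Disjoint A B) (hA : A ⊆ W)
    (hB : B ⊆ W) : totalVar u A + totalVar u B ≤ totalVar u W := by
  refine ENNReal.biSup_add_biSup_le' (p := fun ψ : testFields A => ∀ x, ‖ψ.1 x‖ ≤ 1)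
    (q := fun ψ : testFields B => ∀ x, ‖ψ.1 x‖ ≤ 1) ⟨0, fun x => by simp⟩ ⟨0, fun x => by simp⟩
    fun ψ hψ ψ' hψ' => ?_
  have e : ∀ {V} (h : V ⊆ W) (ψ : testFields V),
    symPairing u W (inclTest h ψ) = symPairing u V ψ := fun _ _ => rfl
  rcases le_total (symPairing u A ψ) 0 with h | h
  · rw [ENNReal.ofReal_of_nonpos h, zero_add]
    exact (le_totalVar u ψ' hψ').trans (totalVar_mono u hB)
  rcases le_total (symPairing u B ψ') 0 with h' | h'
  · rw [ENNReal.ofReal_of_nonpos h', add_zero]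
    exact (le_totalVar u ψ hψ).trans (totalVar_mono u hA)
  rw [← ENNReal.ofReal_add h h', ← e hA, ← e hB, ← map_add]
  exact le_totalVar u _ (norm_add_le_one_of_disjoint ψ.2.2.2 ψ'.2.2.2 hAB hψ hψ')

theorem sum_totalVar_le (u : L1loc d) {ι : Type*} (s : Finset ι) (A : ι → Set (Rd d))
    (hA : Pairwise (Function.onFun Disjoint A)) :
    ∑ i ∈ s, totalVar u (A i) ≤ totalVar u (⋃ i ∈ s, A i) := by
  classical
  induction s using Finset.induction_on with
  | empty => simp
  | insert a s ha ih =>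
    rw [Finset.sum_insert ha, Finset.set_biUnion_insert]
    refine (add_le_add le_rfl ih).trans
      (totalVar_add_le u ?_ Set.subset_union_left Set.subset_union_right)
    refine Set.disjoint_iUnion₂_right.2 fun i hi => hA ?_
    rintro rfl
    exact ha hi

theorem exists_isCompact_lt_totalVar {u : L1loc d} {U : Set (Rd d)} {t : ℝ≥0∞}
    (h : t < totalVar u U) : ∃ K ⊆ U, IsCompact K ∧ ∀ V, K ⊆ V → t < totalVar u V := by
  obtain ⟨ψ, hψ⟩ := lt_iSup_iff.1 h
  obtain ⟨hψ1, hψt⟩ := lt_iSup_iff.1 hψ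
  exact ⟨tsupport ψ.1, ψ.2.2.2, ψ.2.2.1, fun V hV =>
    hψt.trans_le (le_totalVar u (⟨ψ.1, ψ.2.1, ψ.2.2.1, hV⟩ : testFields V) hψ1)⟩

/-- K is the support of an almost optimal test field. `totalVar` makes sense on any set, so this
field already nearly exhausts the variation on K, and superadditivity leaves at most ε for U \ K. -/
theorem exists_isCompact_totalVar_diff_le {u : L1loc d} {U : Set (Rd d)} (h : totalVar u U ≠ ⊤)
    {ε : ℝ≥0∞} (hε : ε ≠ 0) : ∃ K ⊆ U, IsCompact K ∧ totalVar u (U \ K) ≤ ε := by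
  rcases eq_or_ne (totalVar u U) 0 with h0 | h0
  · exact ⟨∅, Set.empty_subset _, isCompact_empty, by simp [h0]⟩
  obtain ⟨ψ, hψ⟩ := lt_iSup_iff.1 (ENNReal.sub_lt_self h h0 hε)
  obtain ⟨hψ1, hψt⟩ := lt_iSup_iff.1 hψ
  refine ⟨tsupport ψ.1, ψ.2.2.2, ψ.2.2.1, ?_⟩
  have h1 : totalVar u U ≤ totalVar u (tsupport ψ.1) + ε := by
    refine (tsub_le_iff_right.1 hψt.le).trans (add_le_add ?_ le_rfl)
    exact le_totalVar u (⟨ψ.1, ψ.2.1, ψ.2.2.1, subset_rfl⟩ : testFields (tsupport ψ.1)) hψ1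
  have h2 := totalVar_add_le u (Set.disjoint_sdiff_right (s := tsupport ψ.1) (t := U))
    ψ.2.2.2 Set.sdiff_subset
  exact (ENNReal.add_le_add_iff_left
    (((totalVar_mono u ψ.2.2.2).trans_lt h.lt_top).ne)).1 (h2.trans h1)

theorem exists_subset_closedBall {U : Set (Rd d)} (h : Bornology.IsBounded U) :
    ∃ k : ℕ, U ⊆ Metric.closedBall 0 k := by
  obtain ⟨r, hr⟩ := h.subset_closedBall 0
  obtain ⟨k, hk⟩ := exists_nat_ge r
  exact ⟨k, hr.trans (Metric.closedBall_subset_closedBall hk)⟩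

theorem continuous_symPairing {U : Set (Rd d)} (ψ : testFields U) :
    Continuous fun u => symPairing u U ψ := by
  obtain ⟨M, hM⟩ := (hasCompactSupport_symDiv ψ.2.2.1).exists_bound_of_continuous
    (continuous_symDiv ψ.2.1)
  obtain ⟨k, hk⟩ := exists_subset_closedBall ψ.2.2.1.isCompact.isBounded
  rw [continuous_iff_continuousAt]
  intro u
  have key : ∀ v : L1loc d,
      edist (symPairing v U ψ) (symPairing u U ψ) ≤ ENNReal.ofReal M * (v - u).ballNorm k := by
    intro v
    rw [edist_eq_enorm_sub, symPairing_apply, symPairing_apply, neg_sub_neg,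
      ← integral_sub (integrable_inner_symDiv u ψ.2) (integrable_inner_symDiv v ψ.2)]
    refine (enorm_integral_le_lintegral_enorm _).trans ?_
    rw [L1loc.ballNorm, ← lintegral_const_mul' _ _ ENNReal.ofReal_ne_top,
      ← lintegral_indicator measurableSet_closedBall]
    apply lintegral_mono_ae
    filter_upwards [L1loc.coeFn_sub v u] with x hx
    rw [← inner_sub_left]
    by_cases hxk : x ∈ Metric.closedBall (0 : Rd d) k
    · rw [Set.indicator_of_mem hxk, hx, ← ofReal_norm, ← ofReal_norm,
        ← ENNReal.ofReal_mul ((norm_nonneg _).trans (hM x))]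
      refine ENNReal.ofReal_le_ofReal ((norm_inner_le_norm _ _).trans ?_)
      rw [mul_comm, norm_sub_rev]
      exact mul_le_mul_of_nonneg_right (hM x) (norm_nonneg _)
    · have : symDiv ψ.1 x = 0 := image_eq_zero_of_notMem_tsupport fun h =>
        hxk (hk (tsupport_symDiv_subset _ h))
      simp [this]
  rw [ContinuousAt, (L1loc.nhds_basis u).tendsto_iff Metric.nhds_basis_eball]
  intro ε hε
  refine ⟨(k, ε / ENNReal.ofReal M), ENNReal.div_pos hε.ne' ENNReal.ofReal_ne_top, fun v hv => ?_⟩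
  refine (key v).trans_lt ?_
  rw [mul_comm]
  exact ENNReal.mul_lt_of_lt_div hv

theorem lowerSemicontinuous_totalVar (U : Set (Rd d)) :
    LowerSemicontinuous fun u : L1loc d => totalVar u U :=
  lowerSemicontinuous_iSup fun ψ => lowerSemicontinuous_iSup fun _ =>
    (ENNReal.continuous_ofReal.comp (continuous_symPairing ψ)).lowerSemicontinuous

/-- Multiplication of a test field by a smooth function. -/
def mulTest {U : Set (Rd d)} {φ : Rd d → ℝ} (hφ : ContDiff ℝ ∞ φ) (ψ : testFields U) :
    testFields U :=
  ⟨fun x => φ x • ψ.1 x, hφ.smul ψ.2.1, ψ.2.2.1.smul_left (f := φ),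
    (tsupport_smul_subset_right φ ψ.1).trans ψ.2.2.2⟩

/-- By duality, the product rule E(φy + (1-φ)z) = φEy + (1-φ)Ez + ∇φ ⊙ (y-z): the fields φψ and
(1-φ)ψ are again admissible. -/
theorem totalVar_blend_le {φ : Rd d → ℝ} (hφ : IsCutoff φ) {M : ℝ≥0}
    (hM : ∀ x, ‖symDivL d‖ * ‖fderiv ℝ φ x‖ ≤ M) (y z : L1loc d) {S : Set (Rd d)}
    (hS : MeasurableSet S) :
    totalVar (blend hφ y z) S ≤
      totalVar y S + totalVar z S + M * ∫⁻ x in S, ‖(y - z : L1loc d) x‖ₑ := by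
  refine iSup₂_le fun ψ hψ => ?_
  have hφ' : ContDiff ℝ ∞ fun x => 1 - φ x := contDiff_const.sub hφ.contDiff
  have hd : ∀ x, fderiv ℝ (fun x => 1 - φ x) x = - fderiv ℝ φ x := fun x => by
    rw [fderiv_const_sub]
  have h1 : ∀ x, ‖(mulTest hφ.contDiff ψ).1 x‖ ≤ 1 := fun x => by
    change ‖φ x • ψ.1 x‖ ≤ 1
    rw [norm_smul, Real.norm_of_nonneg (hφ.nonneg x)]
    exact mul_le_one₀ (hφ.le_one x) (norm_nonneg _) (hψ x)
  have h2 : ∀ x, ‖(mulTest hφ' ψ).1 x‖ ≤ 1 := fun x => by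
    change ‖(1 - φ x) • ψ.1 x‖ ≤ 1
    rw [norm_smul, Real.norm_of_nonneg (sub_nonneg.2 (hφ.le_one x))]
    exact mul_le_one₀ (by linarith [hφ.nonneg x]) (norm_nonneg _) (hψ x)
  -- The term in which the derivative falls on φ. It has opposite signs in the two products, so only
  -- `y - z` is paired with it.
  let w : Rd d → Rd d := fun x => symDivL d ((fderiv ℝ φ x).smulRight (ψ.1 x))
  have hpt : ∀ᵐ x ∂volume, inner ℝ (blend hφ y z x) (symDiv ψ.1 x) =
      inner ℝ (y x) (symDiv (mulTest hφ.contDiff ψ).1 x) +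
      inner ℝ (z x) (symDiv (mulTest hφ' ψ).1 x) - inner ℝ ((y - z : L1loc d) x) (w x) := by
    filter_upwards [coeFn_blend hφ y z, L1loc.coeFn_sub y z] with x hx hx'
    have e1 : symDiv (mulTest hφ.contDiff ψ).1 x = φ x • symDiv ψ.1 x + w x :=
      symDiv_smul hφ.contDiff ψ.2.1 x
    have e2 : symDiv (mulTest hφ' ψ).1 x = (1 - φ x) • symDiv ψ.1 x - w x := by
      have := symDiv_smul hφ' ψ.2.1 x
      rw [hd] at this
      change symDiv (fun x => (1 - φ x) • ψ.1 x) x = _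
      have hn : (-fderiv ℝ φ x).smulRight (ψ.1 x) = -(fderiv ℝ φ x).smulRight (ψ.1 x) := by
        ext v
        simp
      rw [this, hn, map_neg, ← sub_eq_add_neg]
    rw [hx, hx', e1, e2]
    simp only [inner_add_left, inner_add_right, inner_sub_left, inner_sub_right, inner_smul_left,
      inner_smul_right, RCLike.conj_to_real]
    ring
  have hwc : Continuous w := (symDivL d).continuous.comp
    ((ContinuousLinearMap.smulRightL ℝ (Rd d) (Rdd d)).continuous₂.comp
      ((hφ.contDiff.continuous_fderiv (by simp)).prodMk ψ.2.1.continuous))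
  have hw0 : ∀ x, ψ.1 x = 0 → w x = 0 := fun x hx => by
    have : (fderiv ℝ φ x).smulRight (ψ.1 x) = 0 := by rw [hx]; ext; simp
    simp only [w, this, map_zero]
  have hws : HasCompactSupport w := ψ.2.2.1.mono fun x hx h => hx (hw0 x h)
  have hint := integrable_inner_of_hasCompactSupport (y - z) hwc hws
  have hpair : symPairing (blend hφ y z) S ψ = symPairing y S (mulTest hφ.contDiff ψ) +
      symPairing z S (mulTest hφ' ψ) + ∫ x, inner ℝ ((y - z : L1loc d) x) (w x) := by
    simp only [symPairing_apply]
    have i1 := integrable_inner_symDiv y (mulTest hφ.contDiff ψ).2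
    have i2 := integrable_inner_symDiv z (mulTest hφ' ψ).2
    have e := integral_sub (i1.add i2) hint
    simp only [Pi.add_apply] at e
    rw [integral_congr_ae hpt, e, integral_add i1 i2]
    ring
  rw [hpair]
  refine ENNReal.ofReal_add_le.trans (add_le_add (ENNReal.ofReal_add_le.trans
    (add_le_add (le_totalVar y _ h1) (le_totalVar z _ h2))) ?_)
  refine (Real.ofReal_le_enorm _).trans ((enorm_integral_le_lintegral_enorm _).trans ?_)
  rw [← lintegral_const_mul' _ _ ENNReal.coe_ne_top, ← lintegral_indicator hS]
  refine lintegral_mono fun x => ?_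
  by_cases hx : x ∈ S
  · rw [Set.indicator_of_mem hx, ← ofReal_norm, ← ofReal_norm, ← ENNReal.ofReal_coe_nnreal,
      ← ENNReal.ofReal_mul (NNReal.coe_nonneg M), mul_comm]
    refine ENNReal.ofReal_le_ofReal ((norm_inner_le_norm _ _).trans
      (mul_le_mul_of_nonneg_left ?_ (norm_nonneg _)))
    refine ((symDivL d).le_opNorm _).trans (le_trans ?_ (hM x))
    rw [ContinuousLinearMap.norm_smulRight_apply]
    gcongr
    exact mul_le_of_le_one_right (norm_nonneg _) (hψ x)
  · have : w x = 0 := hw0 x (image_eq_zero_of_notMem_tsupport fun h => hx (ψ.2.2.2 h))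
    simp [this]

end TotalVar

/-! ### General properties of Γ-limits. -/

section Gamma

variable {X : Type*} [TopologicalSpace X] {f g : ℕ → X → ℝ≥0∞} {x : X}

theorem gammaLiminf_le_gammaLimsup (f : ℕ → X → ℝ≥0∞) (x : X) :
    gammaLiminf f x ≤ gammaLimsup f x :=
  iSup₂_mono fun _ _ => liminf_le_limsup

theorem eventually_exists_lt_of_gammaLimsup_lt {a : ℝ≥0∞} (h : gammaLimsup f x < a) {V : Set X}
    (hV : V ∈ 𝓝 x) : ∀ᶠ n in atTop, ∃ y ∈ V, f n y < a := by
  have h1 : limsup (fun n => ⨅ y ∈ V, f n y) atTop < a :=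
    (le_iSup₂ (f := fun V (_ : V ∈ 𝓝 x) => limsup (fun n => ⨅ y ∈ V, f n y) atTop) V hV).trans_lt h
  filter_upwards [eventually_lt_of_limsup_lt h1] with n hn
  simpa [iInf_lt_iff] using hn

theorem gammaLimsup_le {a : ℝ≥0∞} (h : ∀ V ∈ 𝓝 x, ∀ᶠ n in atTop, ∃ y ∈ V, f n y ≤ a) :
    gammaLimsup f x ≤ a := by
  refine iSup₂_le fun V hV => limsup_le_of_le (by isBoundedDefault) ?_
  filter_upwards [h V hV] with n ⟨y, hy, hya⟩
  exact (iInf₂_le y hy).trans hya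

theorem frequently_exists_lt_of_gammaLiminf_lt {a : ℝ≥0∞} (h : gammaLiminf f x < a) {V : Set X}
    (hV : V ∈ 𝓝 x) : ∃ᶠ n in atTop, ∃ y ∈ V, f n y < a := by
  have h1 : liminf (fun n => ⨅ y ∈ V, f n y) atTop < a :=
    (le_iSup₂ (f := fun V (_ : V ∈ 𝓝 x) => liminf (fun n => ⨅ y ∈ V, f n y) atTop) V hV).trans_lt h
  refine (frequently_lt_of_liminf_lt (by isBoundedDefault) h1).mono fun n hn => ?_
  simpa [iInf_lt_iff] using hn

theorem gammaLimsup_mono (h : ∀ n y, f n y ≤ g n y) : gammaLimsup f x ≤ gammaLimsup g x :=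
  iSup₂_mono fun _ _ => limsup_le_limsup (.of_forall fun n => iInf₂_mono fun y _ => h n y)

theorem gammaLiminf_mono (h : ∀ n y, f n y ≤ g n y) : gammaLiminf f x ≤ gammaLiminf g x :=
  iSup₂_mono fun _ _ => liminf_le_liminf (.of_forall fun n => iInf₂_mono fun y _ => h n y)

theorem liminf_add_liminf_le (u v : ℕ → ℝ≥0∞) :
    liminf u atTop + liminf v atTop ≤ liminf (fun n => u n + v n) atTop := by
  rw [liminf_eq_iSup_iInf_of_nat, liminf_eq_iSup_iInf_of_nat, liminf_eq_iSup_iInf_of_nat]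
  refine ENNReal.iSup_add_iSup_le fun N M => ?_
  refine le_trans ?_ (le_iSup (fun N => ⨅ n ≥ N, (u n + v n)) (max N M))
  exact le_iInf₂ fun n hn => add_le_add (iInf₂_le n ((le_max_left N M).trans hn))
    (iInf₂_le n ((le_max_right N M).trans hn))

theorem gammaLiminf_add_le :
    gammaLiminf f x + gammaLiminf g x ≤ gammaLiminf (fun n y => f n y + g n y) x := by
  refine ENNReal.biSup_add_biSup_le' (p := fun V => V ∈ 𝓝 x) (q := fun V => V ∈ 𝓝 x)
    ⟨Set.univ, univ_mem⟩ ⟨Set.univ, univ_mem⟩ fun V hV W hW => ?_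
  refine le_trans ?_ (le_iSup₂ (f := fun V (_ : V ∈ 𝓝 x) =>
    liminf (fun n => ⨅ y ∈ V, (f n y + g n y)) atTop) (V ∩ W) (inter_mem hV hW))
  refine (liminf_add_liminf_le _ _).trans (liminf_le_liminf (.of_forall fun n => ?_))
  exact le_iInf₂ fun y hy => add_le_add (iInf₂_le y hy.1) (iInf₂_le y hy.2)

theorem lowerSemicontinuous_gammaLimsup (f : ℕ → X → ℝ≥0∞) :
    LowerSemicontinuous (gammaLimsup f) := by
  intro x a ha
  obtain ⟨V, hV⟩ := lt_iSup_iff.1 ha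
  obtain ⟨hVx, hVa⟩ := lt_iSup_iff.1 hV
  filter_upwards [eventually_mem_nhds_iff.2 hVx] with y hy
  exact hVa.trans_le (le_iSup₂ (f := fun V (_ : V ∈ 𝓝 y) =>
    limsup (fun n => ⨅ y ∈ V, f n y) atTop) V hy)

theorem gammaLimsup_le_apply {a : X → ℝ≥0∞} (h : ∀ n y, f n y ≤ a y) : gammaLimsup f x ≤ a x :=
  gammaLimsup_le fun _ hV => .of_forall fun n => ⟨x, mem_of_mem_nhds hV, h n x⟩

/-- A lower semicontinuous lower bound passes to the Γ-lower limit. -/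
theorem le_gammaLiminf_add {t : X → ℝ≥0∞} (ht : LowerSemicontinuous t) {c : ℝ≥0∞}
    (h : ∀ n y, t y ≤ f n y + c) : t x ≤ gammaLiminf f x + c := by
  refine le_of_forall_lt fun s hs => ?_
  by_contra! hlt
  have hfin : gammaLiminf f x ≠ ⊤ := fun h => by simp [h] at hlt; simp [hlt] at hs
  obtain ⟨s', hs', hs't⟩ := exists_between hs
  have h1 : gammaLiminf f x + c < s' := hlt.trans_lt hs'
  have h2 : gammaLiminf f x < s' - c := lt_tsub_iff_right.2 h1
  -- Lower semicontinuity supplies a neighbourhood of `x` where `t > s'`; a point of low energy in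
  -- it contradicts the lower bound.
  obtain ⟨n, y, hy, hn⟩ := (frequently_exists_lt_of_gammaLiminf_lt h2 (ht x s' hs't)).exists
  exact absurd ((h n y).trans (lt_tsub_iff_right.1 hn).le) (not_le.2 hy)

/-- A perturbation estimate passes to the Γ-upper limit. -/
theorem gammaLimsup_add_le {X : Type*} [TopologicalSpace X] [AddGroup X] {f : ℕ → X → ℝ≥0∞}
    (h : X) (hh : Continuous fun x : X => x + h) {c : ℝ≥0∞}
    (hf : ∀ n y, f n (y + h) ≤ f n y + c) (x : X) :
    gammaLimsup f (x + h) ≤ gammaLimsup f x + c := by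
  refine ENNReal.le_of_forall_pos_le_add fun ε hε hlt => ?_
  have hfin : gammaLimsup f x ≠ ⊤ := fun h => by simp [h] at hlt
  have h1 : gammaLimsup f x < gammaLimsup f x + ε :=
    ENNReal.lt_add_right hfin (by exact_mod_cast hε.ne')
  refine gammaLimsup_le fun V hV => ?_
  filter_upwards [eventually_exists_lt_of_gammaLimsup_lt h1 (hh.continuousAt.preimage_mem_nhds hV)]
    with n ⟨y, hy, hn⟩
  refine ⟨y + h, hy, (hf n y).trans ?_⟩
  rw [add_right_comm]
  gcongr

/-- **Compactness of Γ-convergence**, for countably many sequences simultaneously. -/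
theorem exists_strictMono_gammaLimsup_le [SecondCountableTopology X] {ι : Type*} [Countable ι]
    (f : ι → ℕ → X → ℝ≥0∞) :
    ∃ k : ℕ → ℕ, StrictMono k ∧ ∀ i x,
      gammaLimsup (fun n => f i (k n)) x ≤ gammaLiminf (fun n => f i (k n)) x := by
  have := (countable_countableBasis X).to_subtype
  let a : ℕ → (ι × countableBasis X) → ℝ≥0∞ := fun n p => ⨅ y ∈ (p.2 : Set X), f p.1 n y
  -- Infima over basic open sets live in a countable power of [0,∞], a sequentially compact space.
  -- Convergence of all of them suffices, since basic neighbourhoods determine both Γ-limits.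
  obtain ⟨l, k, hk, hl⟩ := CompactSpace.tendsto_subseq a
  refine ⟨k, hk, fun i x => iSup₂_le fun V hV => ?_⟩
  obtain ⟨b, hb, hxb, hbV⟩ := (isBasis_countableBasis X).mem_nhds_iff.1 hV
  have ht : Tendsto (fun n => ⨅ y ∈ b, f i (k n) y) atTop (𝓝 (l (i, ⟨b, hb⟩))) :=
    (tendsto_pi_nhds.1 hl) (i, ⟨b, hb⟩)
  calc limsup (fun n => ⨅ y ∈ V, f i (k n) y) atTop
      ≤ limsup (fun n => ⨅ y ∈ b, f i (k n) y) atTop :=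
        limsup_le_limsup (.of_forall fun n => biInf_mono hbV)
    _ = liminf (fun n => ⨅ y ∈ b, f i (k n) y) atTop := by rw [ht.limsup_eq, ht.liminf_eq]
    _ ≤ _ := le_iSup₂ (f := fun V (_ : V ∈ 𝓝 x) => liminf (fun n => ⨅ y ∈ V, f i (k n) y) atTop) b
        ((isOpen_of_mem_countableBasis hb).mem_nhds hxb)

end Gamma

/-! ### Consequences of the axioms of the class on open sets. -/

section ClassFBasic

variable {d : ℕ} {c₁ c₂ c₃ c₄ c₅ : ℝ≥0} {σ : ℝ≥0 → ℝ≥0} {F : L1loc d → BorelSets d → ℝ≥0∞}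

theorem ClassF.mono (hF : ClassF c₁ c₂ c₃ c₄ c₅ σ F) (u : L1loc d) {U V : Opens (Rd d)}
    (h : U ≤ V) : F u (openSet U) ≤ F u (openSet V) := by
  obtain ⟨μ, hμ⟩ := hF.measure u
  rw [hμ, hμ]
  exact measure_mono h

theorem ClassF.bot (hF : ClassF c₁ c₂ c₃ c₄ c₅ σ F) (u : L1loc d) : F u (openSet ⊥) = 0 := by
  obtain ⟨μ, hμ⟩ := hF.measure u
  rw [hμ]
  exact measure_empty

theorem ClassF.le_add_add (hF : ClassF c₁ c₂ c₃ c₄ c₅ σ F) (u : L1loc d)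
    {W P Q S : Opens (Rd d)} (h : W ≤ P ⊔ Q ⊔ S) :
    F u (openSet W) ≤ F u (openSet P) + F u (openSet Q) + F u (openSet S) := by
  obtain ⟨μ, hμ⟩ := hF.measure u
  simp only [hμ]
  refine (measure_mono h).trans ?_
  exact (measure_union_le _ _).trans (add_le_add (measure_union_le _ _) le_rfl)

theorem ClassF.add_le (hF : ClassF c₁ c₂ c₃ c₄ c₅ σ F) (u : L1loc d)
    {A B : Opens (Rd d)} (h : Disjoint (A : Set (Rd d)) B) :
    F u (openSet A) + F u (openSet B) ≤ F u (openSet (A ⊔ B)) := by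
  obtain ⟨μ, hμ⟩ := hF.measure u
  simp only [hμ]
  exact (measure_union h B.isOpen.measurableSet).ge

/-- Written with `totalVar`, coercivity needs no case distinction: outside BD the functional is
infinite. -/
theorem ClassF.mul_totalVar_le (hF : ClassF c₁ c₂ c₃ c₄ c₅ σ F) (u : L1loc d) {U : Opens (Rd d)}
    (hU : Bornology.IsBounded (U : Set (Rd d))) :
    c₁ * totalVar u U ≤ F u (openSet U) + c₂ * volume (U : Set (Rd d)) := by
  by_cases h : totalVar u U = ⊤
  · rw [hF.eq_top U hU u fun h' => (isBD_iff U.isOpen hU).1 h' h, top_add]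
    exact le_top
  · obtain ⟨μ, hμ, -⟩ := exists_isSymGradient h
    rw [← variation_eq_totalVar U.isOpen hμ]
    exact hF.lower_bound U hU u ((isBD_iff U.isOpen hU).2 h) μ hμ

/-- Positivity of c₃ matters outside BD, where the bound must be infinite although 0 · ∞ = 0 in
`ℝ≥0∞`. -/
theorem ClassF.le_mul_totalVar (hF : ClassF c₁ c₂ c₃ c₄ c₅ σ F) (hc₃ : 0 < c₃) (u : L1loc d)
    {U : Opens (Rd d)} (hU : Bornology.IsBounded (U : Set (Rd d))) :
    F u (openSet U) ≤ c₃ * totalVar u U + c₄ * volume (U : Set (Rd d)) := by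
  by_cases h : totalVar u U = ⊤
  · rw [h, ENNReal.mul_top (by exact_mod_cast hc₃.ne'), top_add]
    exact le_top
  · obtain ⟨μ, hμ, -⟩ := exists_isSymGradient h
    rw [← variation_eq_totalVar U.isOpen hμ]
    exact hF.upper_bound U hU u ((isBD_iff U.isOpen hU).2 h) μ hμ

end ClassFBasic

/-! ### The fundamental estimate: cut-offs and choice of a cheap layer. -/

section Fundamental

variable {d : ℕ}

theorem exists_isCutoff {K : Set (Rd d)} (hK : IsCompact K) {A : Set (Rd d)} (hA : IsOpen A)
    (hKA : K ⊆ A) : ∃ η : Rd d → ℝ, IsCutoff η ∧ (∀ x ∈ K, η x = 1) ∧ ∀ x ∉ A, η x = 0 := by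
  obtain ⟨U, hU, hKU, hUA, hUc⟩ := exists_open_between_and_isCompact_closure hK hA hKA
  obtain ⟨η, hη, hr, hs, h1⟩ := exists_contMDiff_support_eq_eq_one_iff (n := (⊤ : ℕ∞))
    (modelWithCornersSelf ℝ (Rd d)) hU hK.isClosed hKU
  refine ⟨η, ⟨hη.contDiff, ?_, fun x => (hr ⟨x, rfl⟩).1, fun x => (hr ⟨x, rfl⟩).2⟩,
    fun x hx => (h1 x).1 hx, fun x hx => ?_⟩
  · rw [HasCompactSupport, tsupport, hs]; exact hUc
  · by_contra h
    exact hx (hUA (subset_closure (hs ▸ h)))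

/-- The `i`-th cut-off function whose transition takes place where `i < N η < i + 1`. -/
def layer (η : Rd d → ℝ) (N i : ℕ) (x : Rd d) : ℝ :=
  Real.smoothTransition (3 * (N * η x - i) - 1)

theorem isCutoff_layer {η : Rd d → ℝ} (hη : IsCutoff η) (N i : ℕ) : IsCutoff (layer η N i) where
  contDiff := Real.smoothTransition.contDiff.comp
    ((contDiff_const.mul ((contDiff_const.mul hη.contDiff).sub contDiff_const)).sub contDiff_const)
  hasCompactSupport := hη.hasCompactSupport.mono fun x hx h => hx <| by
    refine Real.smoothTransition.zero_of_nonpos ?_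
    rw [h]
    have : (0 : ℝ) ≤ i := Nat.cast_nonneg i
    linarith
  nonneg x := Real.smoothTransition.nonneg _
  le_one x := Real.smoothTransition.le_one _

/-- One constant serves all N layers: the layer is chosen after y and z, whereas the distance
allowed between them must be fixed before. -/
theorem exists_bound_layer {η : Rd d → ℝ} (hη : IsCutoff η) (N : ℕ) :
    ∃ M : ℝ≥0, ∀ i < N, ∀ x, ‖symDivL d‖ * ‖fderiv ℝ (layer η N i) x‖ ≤ M := by
  have h : ∀ i, ∃ M : ℝ≥0, ∀ x, ‖symDivL d‖ * ‖fderiv ℝ (layer η N i) x‖ ≤ M := by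
    intro i
    have hc := isCutoff_layer hη N i
    obtain ⟨C, hC⟩ := (hc.hasCompactSupport.fderiv ℝ).exists_bound_of_continuous
      (hc.contDiff.continuous_fderiv (by simp))
    refine ⟨(‖symDivL d‖ * C).toNNReal, fun x => ?_⟩
    refine (mul_le_mul_of_nonneg_left (hC x) (norm_nonneg (symDivL d))).trans (Real.le_coe_toNNReal _)
  choose M hM using h
  refine ⟨∑ i ∈ Finset.range N, M i, fun i hi x => (hM i x).trans ?_⟩
  exact_mod_cast Finset.single_le_sum (f := M) (fun _ _ => zero_le) (Finset.mem_range.2 hi)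

/-- The part of the `i`-th transition region contained in `B`. -/
def stripSet {η : Rd d → ℝ} (hη : Continuous η) (N i : ℕ) (B : Opens (Rd d)) : Opens (Rd d) :=
  ⟨(B : Set (Rd d)) ∩ ({x | (i : ℝ) < N * η x} ∩ {x | N * η x < i + 1}),
    B.isOpen.inter ((isOpen_lt continuous_const (continuous_const.mul hη)).inter
      (isOpen_lt (continuous_const.mul hη) continuous_const))⟩

theorem mem_stripSet {η : Rd d → ℝ} {hη : Continuous η} {N i : ℕ} {B : Opens (Rd d)} {x : Rd d} :
    x ∈ (stripSet hη N i B : Set (Rd d)) ↔ x ∈ B ∧ (i : ℝ) < N * η x ∧ N * η x < i + 1 :=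
  Iff.rfl

theorem pairwise_disjoint_stripSet {η : Rd d → ℝ} (hη : Continuous η) (N : ℕ) (B : Opens (Rd d)) :
    Pairwise (Function.onFun Disjoint fun i => (stripSet hη N i B : Set (Rd d))) := by
  intro i j hij
  refine Set.disjoint_left.2 fun x hx hx' => hij ?_
  obtain ⟨-, h1, h2⟩ := mem_stripSet.1 hx
  obtain ⟨-, h3, h4⟩ := mem_stripSet.1 hx'
  have h5 : (i : ℝ) < j + 1 := h1.trans h4
  have h6 : (j : ℝ) < i + 1 := h3.trans h2
  have h5' : i < j + 1 := by exact_mod_cast h5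
  have h6' : j < i + 1 := by exact_mod_cast h6
  omega

variable {c₁ c₂ c₃ c₄ c₅ : ℝ≥0} {σ : ℝ≥0 → ℝ≥0} {F : L1loc d → BorelSets d → ℝ≥0∞}

/-- Locality is only available on open sets, so A' ∪ B is covered by three overlapping ones: where
the glued field is y, where it is z, and the full strip. Growth from above is used only on the
strip. -/
theorem ClassF.blend_layer_le (hF : ClassF c₁ c₂ c₃ c₄ c₅ σ F) (hc₃ : 0 < c₃)
    {A' A B : Opens (Rd d)} (hA : Bornology.IsBounded (A : Set (Rd d)))
    (hB : Bornology.IsBounded (B : Set (Rd d))) {η : Rd d → ℝ} (hη : IsCutoff η)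
    (h1 : ∀ x ∈ A', η x = 1) (h0 : ∀ x ∉ A, η x = 0) {N i : ℕ} (hi : i < N) {M : ℝ≥0}
    (hM : ∀ x, ‖symDivL d‖ * ‖fderiv ℝ (layer η N i) x‖ ≤ M) (y z : L1loc d) :
    F (blend (isCutoff_layer hη N i) y z) (openSet (A' ⊔ B)) ≤
      F y (openSet A) + F z (openSet B) +
      (c₃ * (totalVar y (stripSet hη.contDiff.continuous N i B) +
          totalVar z (stripSet hη.contDiff.continuous N i B)) +
        c₄ * volume (stripSet hη.contDiff.continuous N i B : Set (Rd d)) +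
        c₃ * (M * ∫⁻ x in (A : Set (Rd d)), ‖(y - z : L1loc d) x‖ₑ)) := by
  have hηc := hη.contDiff.continuous
  set w := blend (isCutoff_layer hη N i) y z
  -- The layer function is 1 for `N η ≥ i + 2/3` and 0 for `N η ≤ i + 1/3`; the outer thirds of the
  -- strip are the overlaps.
  let P : Opens (Rd d) := ⟨{x | (i : ℝ) + 2 / 3 < N * η x},
    isOpen_lt continuous_const (continuous_const.mul hηc)⟩
  let Q : Opens (Rd d) :=
    ⟨(B : Set (Rd d)) ∩ {x | N * η x < i + 1 / 3},
      B.isOpen.inter (isOpen_lt (continuous_const.mul hηc) continuous_const)⟩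
  set S := stripSet hηc N i B
  have hN : (i : ℝ) + 1 ≤ N := by exact_mod_cast hi
  have hi0 : (0 : ℝ) ≤ i := Nat.cast_nonneg i
  have hPA : P ≤ A := fun x hx => by
    by_contra h
    have hx' : (i : ℝ) + 2 / 3 < N * η x := hx
    rw [h0 x h, mul_zero] at hx'
    linarith
  have hQB : Q ≤ B := fun x hx => hx.1
  have hSA : S ≤ A := fun x hx => by
    by_contra h
    have hx' : (i : ℝ) < N * η x := (mem_stripSet.1 hx).2.1
    rw [h0 x h, mul_zero] at hx'
    linarith
  have hcover : A' ⊔ B ≤ P ⊔ Q ⊔ S := by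
    rintro x (hx | hx)
    · refine Or.inl (Or.inl ?_)
      change (i : ℝ) + 2 / 3 < N * η x
      rw [h1 x hx]
      linarith
    · by_cases hp : (i : ℝ) + 2 / 3 < N * η x
      · exact Or.inl (Or.inl hp)
      by_cases hq : N * η x < i + 1 / 3
      · exact Or.inl (Or.inr ⟨hx, hq⟩)
      · exact Or.inr (mem_stripSet.2 ⟨hx, by linarith, by linarith⟩)
  have hP : F w (openSet P) ≤ F y (openSet A) := by
    rw [hF.locality P (hA.subset hPA) w y]
    · exact hF.mono y hPA
    · filter_upwards [ae_restrict_of_ae (coeFn_blend (isCutoff_layer hη N i) y z),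
        ae_restrict_mem P.isOpen.measurableSet] with x hx hxP
      have hxP' : (i : ℝ) + 2 / 3 < N * η x := hxP
      have : layer η N i x = 1 := Real.smoothTransition.one_of_one_le (by linarith)
      rw [hx, this]
      simp
  have hQ : F w (openSet Q) ≤ F z (openSet B) := by
    rw [hF.locality Q (hB.subset hQB) w z]
    · exact hF.mono z hQB
    · filter_upwards [ae_restrict_of_ae (coeFn_blend (isCutoff_layer hη N i) y z),
        ae_restrict_mem Q.isOpen.measurableSet] with x hx hxQ
      have hxQ' : N * η x < i + 1 / 3 := hxQ.2
      have : layer η N i x = 0 := Real.smoothTransition.zero_of_nonpos (by linarith)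
      rw [hx, this]
      simp
  refine (hF.le_add_add w hcover).trans (add_le_add (add_le_add hP hQ) ?_)
  refine (hF.le_mul_totalVar hc₃ w (hA.subset hSA)).trans ?_
  calc c₃ * totalVar w S + c₄ * volume (S : Set (Rd d))
      ≤ c₃ * (totalVar y S + totalVar z S + M * ∫⁻ x in (A : Set (Rd d)), ‖(y - z : L1loc d) x‖ₑ)
        + c₄ * volume (S : Set (Rd d)) := by
        gcongr
        refine (totalVar_blend_le (isCutoff_layer hη N i) hM y z S.isOpen.measurableSet).trans ?_
        gcongr
    _ = _ := by ring

/-- Pigeonhole: the N strips are disjoint and contained in A ∩ B, so one of them carries at most the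
average of the total. -/
theorem ClassF.exists_layer_le (hF : ClassF c₁ c₂ c₃ c₄ c₅ σ F) (hc₃ : 0 < c₃)
    {A' A B : Opens (Rd d)} (hA : Bornology.IsBounded (A : Set (Rd d)))
    (hB : Bornology.IsBounded (B : Set (Rd d))) {η : Rd d → ℝ} (hη : IsCutoff η)
    (h1 : ∀ x ∈ A', η x = 1) (h0 : ∀ x ∉ A, η x = 0) {N : ℕ} (hN : 0 < N) {M : ℝ≥0}
    (hM : ∀ i < N, ∀ x, ‖symDivL d‖ * ‖fderiv ℝ (layer η N i) x‖ ≤ M) (y z : L1loc d) :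
    ∃ i, F (blend (isCutoff_layer hη N i) y z) (openSet (A' ⊔ B)) ≤
      F y (openSet A) + F z (openSet B) +
      ((c₃ * (totalVar y A + totalVar z B) + c₄ * volume (A : Set (Rd d))) / N +
        c₃ * (M * ∫⁻ x in (A : Set (Rd d)), ‖(y - z : L1loc d) x‖ₑ)) := by
  have hηc := hη.contDiff.continuous
  let T : ℕ → Set (Rd d) := fun i => stripSet hηc N i B
  have hT : Pairwise (Function.onFun Disjoint T) := pairwise_disjoint_stripSet hηc N B
  let e : ℕ → ℝ≥0∞ := fun i => c₃ * (totalVar y (T i) + totalVar z (T i)) + c₄ * volume (T i)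
  have hTB : ⋃ i ∈ Finset.range N, T i ⊆ (B : Set (Rd d)) :=
    Set.iUnion₂_subset fun i _ x hx => (mem_stripSet.1 hx).1
  have hTA : ⋃ i ∈ Finset.range N, T i ⊆ (A : Set (Rd d)) :=
    Set.iUnion₂_subset fun i _ x hx => by
      by_contra h
      have hx' : (i : ℝ) < N * η x := (mem_stripSet.1 hx).2.1
      rw [h0 x h, mul_zero] at hx'
      have : (0 : ℝ) ≤ i := Nat.cast_nonneg i
      linarith
  have hsum : ∑ i ∈ Finset.range N, e i ≤
      c₃ * (totalVar y A + totalVar z B) + c₄ * volume (A : Set (Rd d)) := by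
    simp only [e]
    rw [Finset.sum_add_distrib, ← Finset.mul_sum, ← Finset.mul_sum, Finset.sum_add_distrib]
    gcongr
    · exact (sum_totalVar_le y _ T hT).trans (totalVar_mono y hTA)
    · exact (sum_totalVar_le z _ T hT).trans (totalVar_mono z hTB)
    · rw [← measure_biUnion_finset (fun i _ j _ hij => hT hij)
        fun i _ => (stripSet hηc N i B).isOpen.measurableSet]
      exact measure_mono hTA
  obtain ⟨i, hi, hei⟩ : ∃ i ∈ Finset.range N,
      e i ≤ (c₃ * (totalVar y A + totalVar z B) + c₄ * volume (A : Set (Rd d))) / N := by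
    by_contra! hlt
    have h2 := ENNReal.sum_lt_sum_of_nonempty (Finset.nonempty_range_iff.2 hN.ne') hlt
    rw [Finset.sum_const, Finset.card_range, nsmul_eq_mul, ENNReal.mul_div_cancel
      (by exact_mod_cast hN.ne') (ENNReal.natCast_ne_top N)] at h2
    exact absurd hsum (not_le.2 h2)
  refine ⟨i, (hF.blend_layer_le hc₃ hA hB hη h1 h0 (Finset.mem_range.1 hi)
    (hM i (Finset.mem_range.1 hi)) y z).trans ?_⟩
  exact add_le_add le_rfl (add_le_add hei le_rfl)

/-- The **fundamental estimate**, in terms of the Γ-upper limit. -/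
theorem gammaLimsup_sup_le {F : ℕ → L1loc d → BorelSets d → ℝ≥0∞}
    (hF : ∀ n, ClassF c₁ c₂ c₃ c₄ c₅ σ (F n)) (hc₁ : 0 < c₁) (hc₃ : 0 < c₃)
    {A' A B : Opens (Rd d)} (hA : Bornology.IsBounded (A : Set (Rd d)))
    (hB : Bornology.IsBounded (B : Set (Rd d)))
    (hA' : closure (A' : Set (Rd d)) ⊆ A) (u : L1loc d) :
    gammaLimsup (fun n w => F n w (openSet (A' ⊔ B))) u ≤
      gammaLimsup (fun n w => F n w (openSet A)) u +
        gammaLimsup (fun n w => F n w (openSet B)) u := by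
  refine ENNReal.le_of_forall_pos_le_add fun ε hε hlt => ?_
  obtain ⟨hfa, hfb⟩ := ENNReal.add_lt_top.1 hlt
  set α := gammaLimsup (fun n w => F n w (openSet A)) u
  set β := gammaLimsup (fun n w => F n w (openSet B)) u
  have hε4 : (ε : ℝ≥0∞) / 4 ≠ 0 := (ENNReal.div_pos (by exact_mod_cast hε.ne') (by norm_num)).ne'
  have hε4' : (ε : ℝ≥0∞) / 4 ≠ ⊤ := (ENNReal.div_lt_top ENNReal.coe_ne_top (by norm_num)).ne
  obtain ⟨η, hη, h1, h0⟩ := exists_isCutoff (hA.subset (subset_closure.trans hA')).isCompact_closure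
    A.isOpen hA'
  have hvA : volume (A : Set (Rd d)) ≠ ⊤ := hA.measure_lt_top.ne
  have hvB : volume (B : Set (Rd d)) ≠ ⊤ := hB.measure_lt_top.ne
  have hc₁' : (c₁ : ℝ≥0∞) ≠ 0 := by exact_mod_cast hc₁.ne'
  -- By coercivity, `C` bounds the total cost of all strips for any near-optimal `y`, `z`, uniformly
  -- in `n`. The choices go in the order `C`, `N`, `M`, `r`.
  obtain ⟨C, hC⟩ : ∃ C : ℝ≥0∞, C = c₃ * ((α + ε / 4 + c₂ * volume (A : Set (Rd d))) / c₁ +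
    (β + ε / 4 + c₂ * volume (B : Set (Rd d))) / c₁) + c₄ * volume (A : Set (Rd d)) := ⟨_, rfl⟩
  have hCtop : C ≠ ⊤ := by
    rw [hC]
    have := hfa.ne
    have := hfb.ne
    finiteness
  obtain ⟨N, hN⟩ := ENNReal.exists_nat_mul_gt hε4 hCtop
  have hN0 : 0 < N := by
    rcases Nat.eq_zero_or_pos N with h | h
    · simp [h] at hN
    · exact h
  have hCN : C / N ≤ ε / 4 := ENNReal.div_le_of_le_mul (by rw [mul_comm]; exact hN.le)
  obtain ⟨M, hM⟩ := exists_bound_layer hη N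
  refine gammaLimsup_le fun W hW => ?_
  obtain ⟨⟨k, δ⟩, hδ, hW⟩ := (L1loc.nhds_basis u).mem_iff.1 hW
  obtain ⟨k', hk'⟩ := exists_subset_closedBall hA
  -- The first bound keeps the glued field in `W`; the second makes the gradient term `c₃ M (2r)` at
  -- most `ε/4`. If `M = 0` the quotient is `⊤` and imposes nothing.
  obtain ⟨r, hr⟩ : ∃ r : ℝ≥0∞, r = min (δ / 2) (ε / 4 / (c₃ * (M * 2))) := ⟨_, rfl⟩
  have hr0 : 0 < r := by
    rw [hr]
    refine lt_min (ENNReal.half_pos hδ.ne') (ENNReal.div_pos hε4 (by finiteness))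
  have hV : {v : L1loc d | (v - u).ballNorm (max k k') < r} ∈ 𝓝 u :=
    (L1loc.nhds_basis u).mem_of_mem (i := (max k k', r)) hr0
  filter_upwards [eventually_exists_lt_of_gammaLimsup_lt (ENNReal.lt_add_right hfa.ne hε4) hV,
    eventually_exists_lt_of_gammaLimsup_lt (ENNReal.lt_add_right hfb.ne hε4) hV]
    with n ⟨y, hy, hyn⟩ ⟨z, hz, hzn⟩
  obtain ⟨i, hi⟩ := (hF n).exists_layer_le hc₃ hA hB hη
    (fun x hx => h1 x (subset_closure hx)) h0 hN0 hM y z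
  refine ⟨_, hW ?_, hi.trans ?_⟩
  · calc (blend (isCutoff_layer hη N i) y z - u).ballNorm k
        ≤ (y - u).ballNorm k + (z - u).ballNorm k := ballNorm_blend_sub_le _ y z u k
      _ ≤ (y - u).ballNorm (max k k') + (z - u).ballNorm (max k k') :=
          add_le_add (L1loc.ballNorm_mono _ (le_max_left _ _))
            (L1loc.ballNorm_mono _ (le_max_left _ _))
      _ < r + r := ENNReal.add_lt_add hy hz
      _ ≤ δ / 2 + δ / 2 := by rw [hr]; gcongr <;> exact min_le_left _ _
      _ = δ := ENNReal.add_halves δ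
  · have hty : totalVar y A ≤ (α + ε / 4 + c₂ * volume (A : Set (Rd d))) / c₁ := by
      rw [ENNReal.le_div_iff_mul_le (Or.inl hc₁') (Or.inl ENNReal.coe_ne_top), mul_comm]
      exact ((hF n).mul_totalVar_le y hA).trans (by gcongr)
    have htz : totalVar z B ≤ (β + ε / 4 + c₂ * volume (B : Set (Rd d))) / c₁ := by
      rw [ENNReal.le_div_iff_mul_le (Or.inl hc₁') (Or.inl ENNReal.coe_ne_top), mul_comm]
      exact ((hF n).mul_totalVar_le z hB).trans (by gcongr)
    have hD : ∫⁻ x in (A : Set (Rd d)), ‖(y - z : L1loc d) x‖ₑ ≤ 2 * r := by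
      calc ∫⁻ x in (A : Set (Rd d)), ‖(y - z : L1loc d) x‖ₑ ≤ (y - z).ballNorm (max k k') :=
            lintegral_mono_set (hk'.trans (Metric.closedBall_subset_closedBall (by
              exact_mod_cast le_max_right k k')))
        _ ≤ (y - u).ballNorm (max k k') + (z - u).ballNorm (max k k') := ballNorm_sub_le y z u _
        _ ≤ r + r := add_le_add hy.le hz.le
        _ = 2 * r := (two_mul r).symm
    calc F n y (openSet A) + F n z (openSet B) +
          ((c₃ * (totalVar y A + totalVar z B) + c₄ * volume (A : Set (Rd d))) / N +
            c₃ * (M * ∫⁻ x in (A : Set (Rd d)), ‖(y - z : L1loc d) x‖ₑ))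
        ≤ (α + ε / 4) + (β + ε / 4) + (C / N + c₃ * (M * (2 * r))) := by
          rw [hC]; gcongr
      _ ≤ (α + ε / 4) + (β + ε / 4) + (ε / 4 + ε / 4) := by
          gcongr
          rw [← mul_assoc (M : ℝ≥0∞), ← mul_assoc]
          refine le_trans ?_ (ENNReal.mul_div_le (a := c₃ * (M * 2)) (b := (ε : ℝ≥0∞) / 4))
          rw [hr]
          gcongr
          exact min_le_right _ _
      _ = α + β + (ε / 4 + ε / 4 + ε / 4 + ε / 4) := by ring
      _ = α + β + ε := by
          congr 1
          rw [← ENNReal.add_div, ← ENNReal.add_div, ← ENNReal.add_div]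
          rw [show (ε : ℝ≥0∞) + ε + ε + ε = ε * 4 by ring]
          exact ENNReal.mul_div_cancel_right (by norm_num) (by norm_num)

end Fundamental

/-! ### The inner regular envelope and its properties on open sets. -/

section InnerRegular

variable {d : ℕ}

/-- `V` is compactly contained in `U`. -/
def CompactlyIn (V U : Opens (Rd d)) : Prop :=
  IsCompact (closure (V : Set (Rd d))) ∧ closure (V : Set (Rd d)) ⊆ U

theorem CompactlyIn.mono {V U W : Opens (Rd d)} (h : CompactlyIn V U) (hUW : U ≤ W) :
    CompactlyIn V W :=
  ⟨h.1, h.2.trans hUW⟩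

theorem CompactlyIn.le {V U : Opens (Rd d)} (h : CompactlyIn V U) : V ≤ U :=
  fun _ hx => h.2 (subset_closure hx)

theorem CompactlyIn.isBounded {V U : Opens (Rd d)} (h : CompactlyIn V U) :
    Bornology.IsBounded (V : Set (Rd d)) :=
  h.1.isBounded.subset subset_closure

theorem CompactlyIn.sup {V W U : Opens (Rd d)} (hV : CompactlyIn V U) (hW : CompactlyIn W U) :
    CompactlyIn (V ⊔ W) U := by
  rw [CompactlyIn, Opens.coe_sup, closure_union]
  exact ⟨hV.1.union hW.1, Set.union_subset hV.2 hW.2⟩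

theorem exists_compactlyIn {K : Set (Rd d)} (hK : IsCompact K) {U : Opens (Rd d)}
    (hKU : K ⊆ U) : ∃ V : Opens (Rd d), K ⊆ V ∧ CompactlyIn V U := by
  obtain ⟨V, hV, hKV, hVU, hVc⟩ := exists_open_between_and_isCompact_closure hK U.isOpen hKU
  exact ⟨⟨V, hV⟩, hKV, hVc, hVU⟩

theorem exists_finite_iSup_between {V : Opens (Rd d)} {U : ℕ → Opens (Rd d)}
    (h : CompactlyIn V (⨆ i, U i)) : ∃ s : Finset ℕ, CompactlyIn V (s.sup U) := by
  obtain ⟨s, hs⟩ := h.1.elim_finite_subcover (fun i => (U i : Set (Rd d)))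
    (fun i => (U i).isOpen) (by simpa [Opens.coe_iSup] using h.2)
  refine ⟨s, h.1, hs.trans ?_⟩
  simp only [Set.iUnion_subset_iff]
  exact fun i hi => Finset.le_sup (f := U) hi

/-- The inner regular envelope of the Γ-upper limit. -/
def innerReg (F : ℕ → L1loc d → BorelSets d → ℝ≥0∞) (u : L1loc d) (U : Opens (Rd d)) : ℝ≥0∞ :=
  ⨆ (V : Opens (Rd d)) (_ : CompactlyIn V U), gammaLimsup (fun n w => F n w (openSet V)) u

variable {c₁ c₂ c₃ c₄ c₅ : ℝ≥0} {σ : ℝ≥0 → ℝ≥0} {F : ℕ → L1loc d → BorelSets d → ℝ≥0∞}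

theorem gammaLimsup_le_innerReg {u : L1loc d} {V U : Opens (Rd d)} (h : CompactlyIn V U) :
    gammaLimsup (fun n w => F n w (openSet V)) u ≤ innerReg F u U :=
  le_iSup₂ (f := fun (V : Opens (Rd d)) (_ : CompactlyIn V U) =>
    gammaLimsup (fun n w => F n w (openSet V)) u) V h

theorem innerReg_mono {u : L1loc d} {U V : Opens (Rd d)} (h : U ≤ V) :
    innerReg F u U ≤ innerReg F u V :=
  iSup₂_le fun _ hW => gammaLimsup_le_innerReg (hW.mono h)

theorem lowerSemicontinuous_innerReg (F : ℕ → L1loc d → BorelSets d → ℝ≥0∞) (U : Opens (Rd d)) :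
    LowerSemicontinuous fun u => innerReg F u U :=
  lowerSemicontinuous_iSup fun _ => lowerSemicontinuous_iSup fun _ =>
    lowerSemicontinuous_gammaLimsup _

theorem innerReg_bot (hF : ∀ n, ClassF c₁ c₂ c₃ c₄ c₅ σ (F n)) (u : L1loc d) :
    innerReg F u ⊥ = 0 := by
  refine le_antisymm (iSup₂_le fun V hV => ?_) zero_le
  obtain rfl : V = ⊥ := le_bot_iff.1 hV.le
  exact gammaLimsup_le_apply (a := fun _ => 0) fun n y => ((hF n).bot y).le

theorem gammaLimsup_openSet_mono (hF : ∀ n, ClassF c₁ c₂ c₃ c₄ c₅ σ (F n)) (u : L1loc d)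
    {U V : Opens (Rd d)} (h : U ≤ V) :
    gammaLimsup (fun n w => F n w (openSet U)) u ≤ gammaLimsup (fun n w => F n w (openSet V)) u :=
  gammaLimsup_mono fun n y => (hF n).mono y h

/-- The compact closure of V splits into a part in A and a part in B. Fattening these leaves the
room between P and P' that the fundamental estimate needs. -/
theorem innerReg_sup_le (hF : ∀ n, ClassF c₁ c₂ c₃ c₄ c₅ σ (F n)) (hc₁ : 0 < c₁) (hc₃ : 0 < c₃)
    (u : L1loc d) (A B : Opens (Rd d)) :
    innerReg F u (A ⊔ B) ≤ innerReg F u A + innerReg F u B := by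
  refine iSup₂_le fun V hV => ?_
  obtain ⟨K, L, hK, hL, hKA, hLB, hKL⟩ :=
    hV.1.binary_compact_cover A.isOpen B.isOpen hV.2
  obtain ⟨P, hKP, hPA⟩ := exists_compactlyIn hK hKA
  obtain ⟨P', hPP', hPA'⟩ := exists_compactlyIn hPA.1 hPA.2
  obtain ⟨Q, hLQ, hQB⟩ := exists_compactlyIn hL hLB
  have hVPQ : V ≤ P ⊔ Q := fun x hx => by
    have : x ∈ K ∪ L := hKL ▸ subset_closure hx
    exact this.imp (fun h => hKP h) fun h => hLQ h
  refine (gammaLimsup_openSet_mono hF u hVPQ).trans ?_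
  refine (gammaLimsup_sup_le hF hc₁ hc₃ hPA'.isBounded hQB.isBounded hPP' u).trans ?_
  exact add_le_add (gammaLimsup_le_innerReg hPA') (gammaLimsup_le_innerReg hQB)

/-- Compact containment reduces the countable union to a finite one. -/
theorem innerReg_iSup_le (hF : ∀ n, ClassF c₁ c₂ c₃ c₄ c₅ σ (F n)) (hc₁ : 0 < c₁) (hc₃ : 0 < c₃)
    (u : L1loc d) (U : ℕ → Opens (Rd d)) :
    innerReg F u (⨆ i, U i) ≤ ∑' i, innerReg F u (U i) := by
  refine iSup₂_le fun V hV => ?_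
  obtain ⟨s, hs⟩ := exists_finite_iSup_between hV
  have h : ∀ s : Finset ℕ, innerReg F u (s.sup U) ≤ ∑ i ∈ s, innerReg F u (U i) := by
    intro s
    induction s using Finset.induction_on with
    | empty => simpa using (innerReg_bot hF u).le
    | insert a s ha ih =>
      rw [Finset.sup_insert, Finset.sum_insert ha]
      exact (innerReg_sup_le hF hc₁ hc₃ u _ _).trans (add_le_add le_rfl ih)
  exact (gammaLimsup_le_innerReg hs).trans ((h s).trans (ENNReal.sum_le_tsum s))

theorem innerReg_le_gammaLimsup (hF : ∀ n, ClassF c₁ c₂ c₃ c₄ c₅ σ (F n)) (u : L1loc d)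
    (U : Opens (Rd d)) : innerReg F u U ≤ gammaLimsup (fun n w => F n w (openSet U)) u :=
  iSup₂_le fun _ hV => gammaLimsup_openSet_mono hF u hV.le

theorem lowerSemicontinuous_mul_totalVar (c : ℝ≥0) (V : Set (Rd d)) :
    LowerSemicontinuous fun u : L1loc d => c * totalVar u V := by
  have hc : Continuous fun t : ℝ≥0∞ => c * t := ENNReal.continuous_const_mul ENNReal.coe_ne_top
  have hm : Monotone fun t : ℝ≥0∞ => c * t := fun a b h => mul_le_mul' le_rfl h
  exact hc.comp_lowerSemicontinuous (lowerSemicontinuous_totalVar V) hm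

/-- A compactly contained V nearly exhausts the total variation, and the bound passes to the Γ-lower
limit on V by lower semicontinuity. -/
theorem mul_totalVar_le_innerReg (hF : ∀ n, ClassF c₁ c₂ c₃ c₄ c₅ σ (F n)) (u : L1loc d)
    (U : Opens (Rd d)) :
    c₁ * totalVar u U ≤ innerReg F u U + c₂ * volume (U : Set (Rd d)) := by
  refine ENNReal.mul_le_of_forall_lt fun a ha t ht => ?_
  obtain ⟨K, hKU, hK, hKt⟩ := exists_isCompact_lt_totalVar ht
  obtain ⟨V, hKV, hV⟩ := exists_compactlyIn hK hKU
  have hlsc := lowerSemicontinuous_mul_totalVar c₁ (V : Set (Rd d))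
  have h1 : c₁ * totalVar u V ≤
      gammaLiminf (fun n w => F n w (openSet V)) u + c₂ * volume (V : Set (Rd d)) :=
    le_gammaLiminf_add hlsc fun n y => (hF n).mul_totalVar_le y hV.isBounded
  have h2 : gammaLiminf (fun n w => F n w (openSet V)) u ≤ innerReg F u U :=
    (gammaLiminf_le_gammaLimsup _ _).trans (gammaLimsup_le_innerReg hV)
  have h3 : volume (V : Set (Rd d)) ≤ volume (U : Set (Rd d)) := measure_mono hV.le
  have h4 : a * t ≤ c₁ * totalVar u V := mul_le_mul' ha.le (hKt V hKV).le
  exact h4.trans (h1.trans (add_le_add h2 (mul_le_mul' le_rfl h3)))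

theorem gammaLimsup_le_mul_totalVar (hF : ∀ n, ClassF c₁ c₂ c₃ c₄ c₅ σ (F n)) (hc₃ : 0 < c₃)
    (u : L1loc d) {U : Opens (Rd d)} (hU : Bornology.IsBounded (U : Set (Rd d))) :
    gammaLimsup (fun n w => F n w (openSet U)) u ≤
      c₃ * totalVar u U + c₄ * volume (U : Set (Rd d)) :=
  gammaLimsup_le_apply (a := fun u : L1loc d => c₃ * totalVar u U + c₄ * volume (U : Set (Rd d)))
    fun n y => (hF n).le_mul_totalVar hc₃ y hU

/-- If u is not in BD(U), coercivity makes the right side infinite. Otherwise the part of U outside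
a large compact set has little energy by the upper bound, and the fundamental estimate joins it to a
compactly contained set. -/
theorem gammaLimsup_le_innerReg_of_isBounded (hF : ∀ n, ClassF c₁ c₂ c₃ c₄ c₅ σ (F n))
    (hc₁ : 0 < c₁) (hc₃ : 0 < c₃) (u : L1loc d) {U : Opens (Rd d)}
    (hU : Bornology.IsBounded (U : Set (Rd d))) :
    gammaLimsup (fun n w => F n w (openSet U)) u ≤ innerReg F u U := by
  have hvol : volume (U : Set (Rd d)) ≠ ⊤ := hU.measure_lt_top.ne
  by_cases htop : totalVar u U = ⊤
  · have h := mul_totalVar_le_innerReg hF u U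
    rw [htop, ENNReal.mul_top (by exact_mod_cast hc₁.ne'), top_le_iff, ENNReal.add_eq_top] at h
    rw [h.resolve_right (ENNReal.mul_ne_top ENNReal.coe_ne_top hvol)]
    exact le_top
  have key : ∀ ε : ℝ≥0, 0 < ε →
      gammaLimsup (fun n w => F n w (openSet U)) u ≤ innerReg F u U + (c₃ + c₄) * ε := by
    intro ε hε
    have hε' : (ε : ℝ≥0∞) ≠ 0 := by exact_mod_cast hε.ne'
    -- `K` captures the variation and `L` the volume up to `ε`; what remains costs at most `(c₃ +
    -- c₄) ε`.
    obtain ⟨K, hKU, hK, hKε⟩ := exists_isCompact_totalVar_diff_le htop hε'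
    obtain ⟨L, hLU, hL, hLε⟩ := U.isOpen.measurableSet.exists_isCompact_sdiff_lt hvol hε'
    obtain ⟨A', hKA', hA'⟩ := exists_compactlyIn (hK.union hL) (Set.union_subset hKU hLU)
    obtain ⟨A, hA'A, hA⟩ := exists_compactlyIn hA'.1 hA'.2
    let B : Opens (Rd d) := ⟨(U : Set (Rd d)) \ (K ∪ L), U.isOpen.sdiff (hK.union hL).isClosed⟩
    have hBU : B ≤ U := Set.sdiff_subset
    have hUAB : U ≤ A' ⊔ B := fun x hx => by
      by_cases h : x ∈ K ∪ L
      · exact Or.inl (hKA' h)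
      · exact Or.inr ⟨hx, h⟩
    have hB := hU.subset hBU
    refine (gammaLimsup_openSet_mono hF u hUAB).trans ?_
    refine (gammaLimsup_sup_le hF hc₁ hc₃ hA.isBounded hB hA'A u).trans ?_
    refine add_le_add (gammaLimsup_le_innerReg hA)
      ((gammaLimsup_le_mul_totalVar hF hc₃ u hB).trans ?_)
    rw [add_mul]
    gcongr
    · exact (totalVar_mono u (Set.sdiff_subset_sdiff_right Set.subset_union_left)).trans hKε
    · exact (measure_mono (Set.sdiff_subset_sdiff_right Set.subset_union_right)).trans hLε.le
  have hc : (0 : ℝ≥0) < c₃ + c₄ := add_pos_of_pos_of_nonneg hc₃ zero_le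
  refine ENNReal.le_of_forall_pos_le_add fun ε hε _ => ?_
  refine (key (ε / (c₃ + c₄)) (div_pos hε hc)).trans ?_
  rw [← ENNReal.coe_add, ← ENNReal.coe_mul, mul_div_cancel₀ _ hc.ne']

theorem innerReg_le_mul_totalVar (hF : ∀ n, ClassF c₁ c₂ c₃ c₄ c₅ σ (F n)) (hc₃ : 0 < c₃)
    (u : L1loc d) {U : Opens (Rd d)} (hU : Bornology.IsBounded (U : Set (Rd d))) :
    innerReg F u U ≤ c₃ * totalVar u U + c₄ * volume (U : Set (Rd d)) :=
  (innerReg_le_gammaLimsup hF u U).trans (gammaLimsup_le_mul_totalVar hF hc₃ u hU)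

/-- Slightly enlarging V and W replaces Γ-upper by Γ-lower limits, which are superadditive. -/
theorem innerReg_add_le (hF : ∀ n, ClassF c₁ c₂ c₃ c₄ c₅ σ (F n))
    (hs : ∀ u V U, CompactlyIn V U → gammaLimsup (fun n w => F n w (openSet V)) u ≤
      gammaLiminf (fun n w => F n w (openSet U)) u)
    (u : L1loc d) {A B : Opens (Rd d)} (h : Disjoint (A : Set (Rd d)) B) :
    innerReg F u A + innerReg F u B ≤ innerReg F u (A ⊔ B) := by
  refine ENNReal.biSup_add_biSup_le' (p := fun V => CompactlyIn V A)
    (q := fun V => CompactlyIn V B) ⟨⊥, by simp [CompactlyIn]⟩ ⟨⊥, by simp [CompactlyIn]⟩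
    fun V hV W hW => ?_
  obtain ⟨V', hV', hVA⟩ := exists_compactlyIn hV.1 hV.2
  obtain ⟨W', hW', hWB⟩ := exists_compactlyIn hW.1 hW.2
  refine (add_le_add (hs u V V' ⟨hV.1, hV'⟩) (hs u W W' ⟨hW.1, hW'⟩)).trans ?_
  refine gammaLiminf_add_le.trans ?_
  refine (gammaLiminf_mono fun n y => (hF n).add_le y (h.mono hVA.le hWB.le)).trans ?_
  refine (gammaLiminf_le_gammaLimsup _ _).trans (gammaLimsup_le_innerReg ?_)
  exact (hVA.mono le_sup_left).sup (hWB.mono le_sup_right)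

end InnerRegular

/-! ### Extension to Borel sets: measure property, perturbations, locality. -/

section LimitFunctional

variable {d : ℕ} {c₁ c₂ c₃ c₄ c₅ : ℝ≥0} {σ : ℝ≥0 → ℝ≥0} {F : ℕ → L1loc d → BorelSets d → ℝ≥0∞}

/-- The outer regular extension of the inner regular envelope to Borel sets. -/
def limitFunctional (F : ℕ → L1loc d → BorelSets d → ℝ≥0∞) (u : L1loc d) (B : BorelSets d) :
    ℝ≥0∞ :=
  ⨅ (U : Opens (Rd d)) (_ : (B : Set (Rd d)) ⊆ U), innerReg F u U

theorem limitFunctional_openSet (u : L1loc d) (U : Opens (Rd d)) :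
    limitFunctional F u (openSet U) = innerReg F u U :=
  le_antisymm (iInf₂_le U le_rfl) (le_iInf₂ fun _ h => innerReg_mono h)

/-- De Giorgi–Letta: countable subadditivity on open sets gives an outer measure with these values,
and superadditivity on disjoint open sets makes it metric, so Borel sets are measurable. -/
theorem exists_measure_limitFunctional (hF : ∀ n, ClassF c₁ c₂ c₃ c₄ c₅ σ (F n)) (hc₁ : 0 < c₁)
    (hc₃ : 0 < c₃)
    (hs : ∀ u V U, CompactlyIn V U → gammaLimsup (fun n w => F n w (openSet V)) u ≤
      gammaLiminf (fun n w => F n w (openSet U)) u) (u : L1loc d) :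
    ∃ μ : Measure (Rd d), ∀ B : BorelSets d, limitFunctional F u B = μ B := by
  let β : ∀ s : Set (Rd d), IsOpen s → ℝ≥0∞ := fun s hs => innerReg F u ⟨s, hs⟩
  have β0 : β ∅ isOpen_empty = 0 := innerReg_bot hF u
  let μ : OuterMeasure (Rd d) := inducedOuterMeasure β isOpen_empty β0
  have hβ : ∀ ⦃f : ℕ → Set (Rd d)⦄ (hm : ∀ i, IsOpen (f i)),
      β (⋃ i, f i) (isOpen_iUnion hm) ≤ ∑' i, β (f i) (hm i) := by
    intro f hm
    have h := innerReg_iSup_le hF hc₁ hc₃ u fun i => ⟨f i, hm i⟩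
    rwa [Opens.iSup_mk] at h
  have hmono : ∀ ⦃s t : Set (Rd d)⦄ (hs : IsOpen s) (ht : IsOpen t), s ⊆ t → β s hs ≤ β t ht :=
    fun s t hs ht h => innerReg_mono h
  have hμ : ∀ s, μ s = ⨅ (t : Set (Rd d)) (ht : IsOpen t) (_ : s ⊆ t), β t ht :=
    inducedOuterMeasure_eq_iInf (fun _ => isOpen_iUnion) hβ hmono
  have hmetric : μ.IsMetric := by
    intro s t hst
    refine le_antisymm (measure_union_le s t) ?_
    -- Sets at positive distance are separated by comparing the distances to each of them.
    obtain ⟨U, V, hU, hV, hsU, htV, hUV⟩ : SeparatedNhds s t := by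
      obtain ⟨r, hr, hst⟩ := hst
      refine ⟨{x | Metric.infEDist x s < Metric.infEDist x t},
        {x | Metric.infEDist x t < Metric.infEDist x s},
        isOpen_lt Metric.continuous_infEDist Metric.continuous_infEDist,
        isOpen_lt Metric.continuous_infEDist Metric.continuous_infEDist, fun x hx => ?_,
        fun x hx => ?_, Set.disjoint_left.2 fun x hx hx' => lt_asymm (a := Metric.infEDist x s) hx hx'⟩
      · rw [Set.mem_ofPred_eq, Metric.infEDist_zero_of_mem hx]
        exact (pos_iff_ne_zero.2 hr).trans_le (Metric.le_infEDist.2 fun y hy => hst x hx y hy)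
      · rw [Set.mem_ofPred_eq, Metric.infEDist_zero_of_mem hx]
        exact (pos_iff_ne_zero.2 hr).trans_le
          (Metric.le_infEDist.2 fun y hy => (hst y hy x hx).trans_eq (edist_comm y x))
    rw [hμ (s ∪ t)]
    refine le_iInf fun W => le_iInf fun hW => le_iInf fun hstW => ?_
    have hsW : s ⊆ U ∩ W := Set.subset_inter hsU (Set.subset_union_left.trans hstW)
    have htW : t ⊆ V ∩ W := Set.subset_inter htV (Set.subset_union_right.trans hstW)
    have h1 : μ s ≤ β (U ∩ W) (hU.inter hW) := by
      rw [hμ]; exact iInf_le_of_le _ (iInf_le_of_le _ (iInf_le _ hsW))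
    have h2 : μ t ≤ β (V ∩ W) (hV.inter hW) := by
      rw [hμ]; exact iInf_le_of_le _ (iInf_le_of_le _ (iInf_le _ htW))
    refine (add_le_add h1 h2).trans ?_
    refine (innerReg_add_le hF hs u (A := ⟨_, hU.inter hW⟩) (B := ⟨_, hV.inter hW⟩)
      (hUV.mono Set.inter_subset_left Set.inter_subset_left)).trans (innerReg_mono ?_)
    exact sup_le Set.inter_subset_right Set.inter_subset_right
  have hle : (inferInstance : MeasurableSpace (Rd d)) ≤ μ.caratheodory := by
    rw [BorelSpace.measurable_eq (α := Rd d)]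
    exact hmetric.borel_le_caratheodory
  refine ⟨μ.toMeasure hle, fun B => ?_⟩
  rw [toMeasure_apply μ hle B.2, hμ]
  refine le_antisymm ?_ ?_
  · exact le_iInf fun W => le_iInf fun hW => le_iInf fun h => iInf₂_le (⟨W, hW⟩ : Opens (Rd d)) h
  · exact le_iInf₂ fun W h => iInf_le_of_le W (iInf_le_of_le W.isOpen (iInf_le _ h))

theorem innerReg_add_le_add (m : Measure (Rd d)) (h : L1loc d)
    (hm : ∀ n w B, F n (w + h) B ≤ F n w B + m (B : Set (Rd d))) (u : L1loc d)
    (U : Opens (Rd d)) : innerReg F (u + h) U ≤ innerReg F u U + m U := by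
  refine iSup₂_le fun V hV => ?_
  refine (gammaLimsup_add_le h (L1loc.continuous_add_right h)
    (fun n w => hm n w (openSet V)) u).trans ?_
  exact add_le_add (gammaLimsup_le_innerReg hV) (measure_mono hV.le)

/-- Common form of (d), (e) and (f). Outer regularity of m lets one open neighbourhood of B be
nearly optimal both for the functional and for m. -/
theorem limitFunctional_add_le (m : Measure (Rd d)) [m.OuterRegular] (h : L1loc d)
    (hm : ∀ n w B, F n (w + h) B ≤ F n w B + m (B : Set (Rd d))) (u : L1loc d)
    (B : BorelSets d) : limitFunctional F (u + h) B ≤ limitFunctional F u B + m B := by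
  rw [Set.measure_eq_iInf_isOpen (B : Set (Rd d)) m]
  have hU : ∀ U : Opens (Rd d), (B : Set (Rd d)) ⊆ U → ∀ W : Set (Rd d), (B : Set (Rd d)) ⊆ W →
      IsOpen W → limitFunctional F (u + h) B ≤ innerReg F u U + m W := by
    intro U hBU W hBW hW
    refine (iInf₂_le (U ⊓ ⟨W, hW⟩) (Set.subset_inter hBU hBW)).trans ?_
    refine (innerReg_add_le_add m h hm u _).trans ?_
    exact add_le_add (innerReg_mono inf_le_left) (measure_mono Set.inter_subset_right)
  have hB : limitFunctional F u B = ⨅ (U : Opens (Rd d)) (_ : (B : Set (Rd d)) ⊆ U),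
    innerReg F u U := rfl
  rw [hB]
  simp only [ENNReal.iInf_add, ENNReal.add_iInf]
  exact le_iInf fun W => le_iInf fun hBW => le_iInf fun hW => le_iInf fun U => le_iInf fun hBU =>
    hU U hBU W hBW hW

/-- Adding u - v, which vanishes on U, does not change the functionals on any V compactly contained
in U, so the perturbation estimate applies with cost 0. Such V are bounded, whence U need not be. -/
theorem innerReg_congr (hF : ∀ n, ClassF c₁ c₂ c₃ c₄ c₅ σ (F n)) {U : Opens (Rd d)}
    {u v : L1loc d} (h : ∀ᵐ x ∂volume.restrict (U : Set (Rd d)), u x = v x) :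
    innerReg F u U = innerReg F v U := by
  have key : ∀ {u v : L1loc d}, (∀ᵐ x ∂volume.restrict (U : Set (Rd d)), u x = v x) →
      innerReg F u U ≤ innerReg F v U := by
    intro u v h
    refine iSup₂_le fun V hV => ?_
    have h1 : ∀ n (w : L1loc d), F n (w + (u - v)) (openSet V) ≤ F n w (openSet V) + 0 := by
      intro n w
      rw [add_zero]
      refine ((hF n).locality V hV.isBounded _ _ ?_).le
      filter_upwards [ae_mono (Measure.restrict_mono_set volume hV.le) h,
        ae_restrict_of_ae (L1loc.coeFn_add w (u - v)), ae_restrict_of_ae (L1loc.coeFn_sub u v)]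
        with x h1 h2 h3
      rw [h2, h3, h1, sub_self, add_zero]
    have h2 := gammaLimsup_add_le (u - v) (L1loc.continuous_add_right (u - v)) h1 v
    rw [add_sub_cancel, add_zero] at h2
    exact h2.trans (gammaLimsup_le_innerReg hV)
  exact le_antisymm (key h) (key (h.mono fun _ hx => hx.symm))

end LimitFunctional

/-! ### Surface measure on a hyperplane. -/

section Hyperplane

variable {d : ℕ}

/-- The restricted measure is the isometric image of Lebesgue measure on the orthogonal complement
of ν. Local finiteness yields the outer regularity needed for the surface estimate. -/
theorem isLocallyFiniteMeasure_hyperplane (x : Rd d) {ν : Rd d} (hν : ν ≠ 0) :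
    IsLocallyFiniteMeasure
      ((μHE[d - 1] : Measure (Rd d)).restrict {y | inner ℝ (y - x) ν = 0}) := by
  let W : Submodule ℝ (Rd d) := (ℝ ∙ ν)ᗮ
  have hW : Module.finrank ℝ W = d - 1 := by
    have h1 : _ + Module.finrank ℝ W = _ := Submodule.finrank_add_finrank_orthogonal (ℝ ∙ ν)
    rw [finrank_span_singleton hν, finrank_euclideanSpace_fin] at h1
    omega
  let f : W → Rd d := fun w => w + x
  have hf : Isometry f := fun a b => by simp [f, Subtype.edist_eq]
  have hr : Set.range f = {y | inner ℝ (y - x) ν = 0} := by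
    ext y
    simp only [Set.mem_range, Set.mem_ofPred_eq, f]
    constructor
    · rintro ⟨w, rfl⟩
      rw [add_sub_cancel_right, real_inner_comm]
      exact Submodule.mem_orthogonal_singleton_iff_inner_right.1 w.2
    · intro h
      exact ⟨⟨y - x, Submodule.mem_orthogonal_singleton_iff_inner_left.2 h⟩, sub_add_cancel y x⟩
  rw [← hr, ← hf.map_euclideanHausdorffMeasure, ← hW,
    InnerProductSpace.euclideanHausdorffMeasure_eq_volume]
  have : IsFiniteMeasureOnCompacts ((volume : Measure W).map f) := by
    refine ⟨fun K hK => ?_⟩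
    rw [Measure.map_apply hf.continuous.measurable hK.measurableSet]
    exact (hf.isClosedEmbedding.isCompact_preimage hK).measure_lt_top
  exact isLocallyFiniteMeasure_of_isFiniteMeasureOnCompacts

end Hyperplane

/-! ### The limit belongs to the class, and the subsequence converges to it. -/

section Compactness

variable {d : ℕ} {c₁ c₂ c₃ c₄ c₅ : ℝ≥0} {σ : ℝ≥0 → ℝ≥0} {F : ℕ → L1loc d → BorelSets d → ℝ≥0∞}

theorem add_affine_add_affine_neg (u : L1loc d) (A : Matrix (Fin d) (Fin d) ℝ) (b : Rd d) :
    u + affine A b + affine (-A) (-b) = u := by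
  rw [add_assoc, affine, affine, L1loc.mk_add_mk]
  refine L1loc.ext ?_
  filter_upwards [L1loc.coeFn_add u _, L1loc.coeFn_mk _ ((locallyIntegrable_affine A b).add
    (locallyIntegrable_affine (-A) (-b)))] with x h1 h2
  refine h1.trans ((congrArg (u x + ·) h2).trans ?_)
  simp only [Pi.add_apply, map_neg, LinearMap.neg_apply]
  abel

theorem classFsc_limitFunctional (hF : ∀ n, ClassF c₁ c₂ c₃ c₄ c₅ σ (F n))
    (hc₁ : 0 < c₁) (hc₃ : 0 < c₃)
    (hs : ∀ u V U, CompactlyIn V U → gammaLimsup (fun n w => F n w (openSet V)) u ≤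
      gammaLiminf (fun n w => F n w (openSet U)) u) :
    ClassFsc c₁ c₂ c₃ c₄ c₅ σ (limitFunctional F) where
  measure := exists_measure_limitFunctional hF hc₁ hc₃ hs
  outer_regular u B := by simp only [limitFunctional_openSet]; rfl
  locality U _ u v h := by
    rw [limitFunctional_openSet, limitFunctional_openSet, innerReg_congr hF h]
  lower_bound U _ u _ μ hμ := by
    rw [limitFunctional_openSet, variation_eq_totalVar U.isOpen hμ]
    exact mul_totalVar_le_innerReg hF u U
  upper_bound U hU u _ μ hμ := by
    rw [limitFunctional_openSet, variation_eq_totalVar U.isOpen hμ]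
    exact innerReg_le_mul_totalVar hF hc₃ u hU
  eq_top U hU u hu := by
    have h := mul_totalVar_le_innerReg hF u U
    rw [isBD_iff U.isOpen hU, not_not] at hu
    rw [hu, ENNReal.mul_top (by exact_mod_cast hc₁.ne'), top_le_iff, ENNReal.add_eq_top] at h
    rw [limitFunctional_openSet]
    exact h.resolve_right (ENNReal.mul_ne_top ENNReal.coe_ne_top hU.measure_lt_top.ne)
  rigid u A b hA B := by
    have key : ∀ (A : Matrix (Fin d) (Fin d) ℝ) (b : Rd d), Aᵀ = -A → ∀ u : L1loc d,
        limitFunctional F (u + affine A b) B ≤ limitFunctional F u B := by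
      intro A b hA u
      have h := limitFunctional_add_le 0 (affine A b)
        (fun n w B => ((hF n).rigid w A b hA B).le.trans le_self_add) u B
      simpa using h
    -- The rigid motion with data `-A`, `-b` undoes the first, which gives the reverse inequality.
    refine le_antisymm (key A b hA u) ?_
    have h := key (-A) (-b) (by rw [Matrix.transpose_neg, hA]) (u + affine A b)
    rwa [add_affine_add_affine_neg] at h
  bulk u A hA B := by
    have hc : (c₅ : ℝ≥0∞) * ENNReal.ofReal (frobNorm A) ≠ ⊤ :=
      ENNReal.mul_ne_top ENNReal.coe_ne_top ENNReal.ofReal_ne_top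
    have : ((c₅ * ENNReal.ofReal (frobNorm A)) • (volume : Measure (Rd d))).OuterRegular :=
      Measure.OuterRegular.smul _ hc
    exact limitFunctional_add_le ((c₅ * ENNReal.ofReal (frobNorm A)) • (volume : Measure (Rd d)))
      (affine A 0) (fun n w B => (hF n).bulk w A hA B) u B
  surface u x ζ ν hν B := by
    have := isLocallyFiniteMeasure_hyperplane x (ν := ν) (by rintro rfl; simp at hν)
    let m : Measure (Rd d) :=
      (μHE[d - 1] : Measure (Rd d)).restrict {y | inner ℝ (y - x) ν = 0}
    have : ((σ ‖ζ‖₊ : ℝ≥0∞) • m).OuterRegular :=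
      Measure.OuterRegular.smul _ ENNReal.coe_ne_top
    have hm : ∀ B : BorelSets d, ((σ ‖ζ‖₊ : ℝ≥0∞) • m) (B : Set (Rd d)) =
        σ ‖ζ‖₊ * μHE[d - 1] ((B : Set (Rd d)) ∩ {y | inner ℝ (y - x) ν = 0}) := by
      intro B
      rw [Measure.smul_apply, smul_eq_mul, Measure.restrict_apply B.2]
    rw [← hm]
    exact limitFunctional_add_le _ (jump x ζ ν)
      (fun n w B => ((hF n).surface w x ζ ν hν B).trans_eq (by rw [hm])) u B
  lsc U := by
    simp only [limitFunctional_openSet]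
    exact lowerSemicontinuous_innerReg F U

/-- The envelope lies below the Γ-lower limit by `hs` and above the Γ-upper limit because U is
bounded. -/
theorem gammaConverges_limitFunctional (hF : ∀ n, ClassF c₁ c₂ c₃ c₄ c₅ σ (F n))
    (hc₁ : 0 < c₁) (hc₃ : 0 < c₃)
    (hs : ∀ u V U, CompactlyIn V U → gammaLimsup (fun n w => F n w (openSet V)) u ≤
      gammaLiminf (fun n w => F n w (openSet U)) u)
    {U : Opens (Rd d)} (hU : Bornology.IsBounded (U : Set (Rd d))) :
    GammaConverges (fun n u => F n u (openSet U)) (fun u => limitFunctional F u (openSet U)) := by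
  intro u
  have h1 := gammaLimsup_le_innerReg_of_isBounded hF hc₁ hc₃ u hU
  have h2 : innerReg F u U ≤ gammaLiminf (fun n w => F n w (openSet U)) u :=
    iSup₂_le fun V hV => hs u V U hV
  have h3 := gammaLiminf_le_gammaLimsup (fun n w => F n w (openSet U)) u
  dsimp only
  rw [limitFunctional_openSet]
  exact ⟨le_antisymm (h3.trans h1) h2, le_antisymm h1 (h2.trans h3)⟩

/-- A subsequence along which the Γ-upper limit on an open set is controlled by the
Γ-lower limit on every larger one. -/
theorem exists_strictMono_gammaLimsup_le_gammaLiminf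
    (hF : ∀ n, ClassF c₁ c₂ c₃ c₄ c₅ σ (F n)) :
    ∃ k : ℕ → ℕ, StrictMono k ∧ ∀ u V U, CompactlyIn V U →
      gammaLimsup (fun n w => F (k n) w (openSet V)) u ≤
        gammaLiminf (fun n w => F (k n) w (openSet U)) u := by
  have hcount := (countable_countableBasis (Rd d)).to_subtype
  -- Finite unions of basic sets form a countable family, and one of them fits between any `V` and
  -- `U` with `V` compactly contained in `U`.
  let R : Finset (countableBasis (Rd d)) → Opens (Rd d) := fun s =>
    s.sup fun b => ⟨b, isOpen_of_mem_countableBasis b.2⟩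
  obtain ⟨k, hk, h⟩ := exists_strictMono_gammaLimsup_le fun s n w => F n w (openSet (R s))
  refine ⟨k, hk, fun u V U hVU => ?_⟩
  obtain ⟨s, hVs, hsU⟩ : ∃ s, V ≤ R s ∧ R s ≤ U := by
    let ι := {b : countableBasis (Rd d) // (b : Set (Rd d)) ⊆ U}
    obtain ⟨t, ht⟩ := hVU.1.elim_finite_subcover (fun i : ι => (i.1 : Set (Rd d)))
      (fun i => isOpen_of_mem_countableBasis i.1.2) (fun x hx => by
        obtain ⟨b, hb, hxb, hbU⟩ := (isBasis_countableBasis (Rd d)).exists_subset_of_mem_open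
          (hVU.2 hx) U.isOpen
        exact Set.mem_iUnion.2 ⟨⟨⟨b, hb⟩, hbU⟩, hxb⟩)
    refine ⟨t.map (Function.Embedding.subtype _), fun x hx => ?_, Finset.sup_le fun b hb => ?_⟩
    · obtain ⟨i, hi, hxi⟩ := Set.mem_iUnion₂.1 (ht (subset_closure hx))
      have := Finset.le_sup (f := fun b : countableBasis (Rd d) =>
        (⟨b, isOpen_of_mem_countableBasis b.2⟩ : Opens (Rd d)))
        (Finset.mem_map_of_mem (Function.Embedding.subtype _) hi)
      exact this hxi
    · obtain ⟨i, -, rfl⟩ := Finset.mem_map.1 hb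
      exact i.2
  calc gammaLimsup (fun n w => F (k n) w (openSet V)) u
      ≤ gammaLimsup (fun n w => F (k n) w (openSet (R s))) u :=
        gammaLimsup_openSet_mono (fun n => hF (k n)) u hVs
    _ ≤ gammaLiminf (fun n w => F (k n) w (openSet (R s))) u := h s u
    _ ≤ gammaLiminf (fun n w => F (k n) w (openSet U)) u :=
        gammaLiminf_mono fun n y => (hF (k n)).mono y hsU

end Compactness

end BDCompactness

end
theorem mainTheorem1 (d : ℕ) (hd : 1 ≤ d) (c₁ c₂ c₃ c₄ c₅ : ℝ≥0) (hc₁ : 0 < c₁) (hc₁₃ : c₁ ≤ c₃)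
    (σ : ℝ≥0 → ℝ≥0) (hσ : Continuous σ) (hσ0 : σ 0 = 0)
    (hσ' : limsup (fun t : ℝ≥0 => ((σ t / t : ℝ≥0) : ℝ≥0∞)) atTop < ⊤)
    (F : ℕ → BDCompactness.L1loc d → BDCompactness.BorelSets d → ℝ≥0∞)
    (hF : ∀ n, BDCompactness.ClassF c₁ c₂ c₃ c₄ c₅ σ (F n)) :
    ∃ (G : BDCompactness.L1loc d → BDCompactness.BorelSets d → ℝ≥0∞) (k : ℕ → ℕ),
      BDCompactness.ClassFsc c₁ c₂ c₃ c₄ c₅ σ G ∧ StrictMono k ∧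
      ∀ U : Opens (BDCompactness.Rd d), Bornology.IsBounded (U : Set (BDCompactness.Rd d)) →
        BDCompactness.GammaConverges
          (fun n u => F (k n) u (BDCompactness.openSet U))
          (fun u => G u (BDCompactness.openSet U)) := by
  obtain ⟨k, hk, hs⟩ := BDCompactness.exists_strictMono_gammaLimsup_le_gammaLiminf hF
  have hc₃ := hc₁.trans_le hc₁₃
  exact ⟨BDCompactness.limitFunctional fun n => F (k n), k,
    BDCompactness.classFsc_limitFunctional (fun n => hF (k n)) hc₁ hc₃ hs, hk,
    fun _ hU => BDCompactness.gammaConverges_limitFunctional (fun n => hF (k n)) hc₁ hc₃ hs hU⟩
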